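/- Let $F$ be a germ of biholomorphism of $\mathbb C^n$ fixing the origin $O$, whose differential at $O$ is diagonalizable with eigenvalues $\lambda_1,\dots,\lambda_n$ (listed with multiplicity), and let $1\le r\le n$. A resonance is a pair $(j,L)$ with $L\in\mathbb N^n$, $|L|\ge 2$ and $\lambda_j=\lambda^L$. Suppose that $F$ is 2-resonant with respect to $\lambda_1,\dots,\lambda_r$: there are $P,Q\in\mathbb N^r\times\{0\}^{n-r}$, linearly independent over $\mathbb Q$, such that the resonances $(j,L)$ with $1\le j\le r$ are precisely those with $L=e_j+k_1P+k_2Q$, $k_1,k_2\in\mathbb N$, $k_1+k_2\ge 1$. Suppose that $|\lambda_j|=1$ for $j\le r$ and $|\lambda_j|<1$ for $j>r$. For $l$ large, $F$ is holomorphically conjugate to a germ in approximate Poincaré–Dulac normal form $$\widetilde F(z)=Dz+\sum_{s=1}^r\sum_{|k_1P+k_2Q|\ge 2}a_{(k_1,k_2),s}\,z^{k_1P+k_2Q}z_s e_s+\sum_{s=r+1}^nR_s(z)e_s+O(\|z\|^l),$$ where $D=\mathrm{Diag}(\lambda_1,\dots,\lambda_n)$ and $R_s(z)=O(\|z\|^2)$.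 Suppose that the weighted order of $F$, i.e. the least $k_0=k_1+k_2\ge 1$ such that $a_{(k_1,k_2),s}\ne 0$ for some $s\le r$, is finite (with $l$ large enough for the form to contain all terms of weight $k_1+k_2\le k_0$). The associated parabolic shadow of $F$ is the map $f(u)=u+H_{k_0+1}(u)$ of $\mathbb C^2$, where $H_{k_0+1}=(Q_1,Q_2)$, $$Q_1(u)=u_1\sum_{k_1+k_2=k_0}\Big(\sum_{j=1}^r p_j\frac{a_{(k_1,k_2),j}}{\lambda_j}\Big)u_1^{k_1}u_2^{k_2},\qquad Q_2(u)=u_2\sum_{k_1+k_2=k_0}\Big(\sum_{j=1}^r q_j\frac{a_{(k_1,k_2),j}}{\lambda_j}\Big)u_1^{k_1}u_2^{k_2}.$$ Suppose that, for some such parabolic shadow $f$ of $F$, there is a vector $v\in\mathbb C^2\setminus\{0\}$ such that 1. $v$ is a normalized non-degenerate characteristic direction of $f$: $H_{k_0+1}(v)=-\frac1{k_0}v$; 2. $F$ is $(f,v)$-irregular-nondegenerate: the direction $[v]=[1:u_0]$ is irregular, i.e. the orders of vanishing $\mu_1,\mu_2\in\mathbb N$ at $u_0$ of $g_1(u)=Q_1(1,u)$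 and $g_2(u)=Q_2(1,u)-uQ_1(1,u)$ (in particular $g_2\not\equiv 0$) satisfy $\mu_2>\mu_1+1$; for $[v]=[0:1]$ the same is required after exchanging the two coordinates of $\mathbb C^2$; 3. $F$ is $(f,v)$-parabolically-attracting: $$\mathrm{Re}\Big(\sum_{k_1+k_2=k_0}\frac{a_{(k_1,k_2),j}}{\lambda_j}v_1^{k_1}v_2^{k_2}\Big)<0\qquad\text{for } j=1,\dots,r.$$ Then $F$ has a basin of attraction with $O$ on its boundary: inside every neighbourhood of $O$ there is a non-empty open set $V$ such that $O\in\partial V$, $F(V)\subseteq V$, and $F^{\circ m}(z)\to O$ as $m\to\infty$ for every $z\in V$. -/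

import Mathlib

open Filter Topology Asymptotics

noncomputable section

namespace TwoResonant

/-- Representatives of elements of `Diff(ℂⁿ, O)`: `F` is holomorphic near the origin, fixes it and
has a holomorphic local inverse there. Only the germ of `F` at `0` matters. -/
def IsGermBiholo {n : ℕ} (F : (Fin n → ℂ) → (Fin n → ℂ)) : Prop :=
  F 0 = 0 ∧ AnalyticAt ℂ F 0 ∧
    ∃ G : (Fin n → ℂ) → (Fin n → ℂ), G 0 = 0 ∧ AnalyticAt ℂ G 0 ∧
      (∀ᶠ z in 𝓝 0, G (F z) = z) ∧ ∀ᶠ z in 𝓝 0, F (G z) = z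

/-- The differential of `F` at the origin is diagonalizable, and `lam 0, …, lam (n - 1)` are its
eigenvalues, listed with multiplicity. -/
def HasEigenvalues {n : ℕ} (F : (Fin n → ℂ) → (Fin n → ℂ)) (lam : Fin n → ℂ) : Prop :=
  ∃ b : Module.Basis (Fin n) ℂ (Fin n → ℂ), ∀ i, fderiv ℂ F 0 (b i) = lam i • b i

/-- The monomial `z ^ L = z₁ ^ l₁ ⋯ zₙ ^ lₙ`. -/
def mono {n : ℕ} (z : Fin n → ℂ) (L : Fin n → ℕ) : ℂ := ∏ i, z i ^ L i

/-- The length `|L| = l₁ + ⋯ + lₙ` of a multi-index. -/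
def len {n : ℕ} (L : Fin n → ℕ) : ℕ := ∑ i, L i

/-- The multi-index `k₁ P + k₂ Q`. -/
def comb {n : ℕ} (P Q : Fin n → ℕ) (k : ℕ × ℕ) : Fin n → ℕ := k.1 • P + k.2 • Q

/-- `(j, L)` is a resonance of `lam`. -/
def IsResonance {n : ℕ} (lam : Fin n → ℂ) (j : Fin n) (L : Fin n → ℕ) : Prop :=
  2 ≤ len L ∧ lam j = mono lam L

/-- `P, Q ∈ ℕ^r × {0}^(n-r)` are linearly independent over `ℚ` and generate the resonances of `lam`
with respect to the first `r` entries: the resonances `(j, L)` with `j` among the first `r` indices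
are precisely those with `L = e_j + k₁ P + k₂ Q`, `k₁ + k₂ ≥ 1`. -/
def AreGenerators {n : ℕ} (lam : Fin n → ℂ) (r : ℕ) (P Q : Fin n → ℕ) : Prop :=
  (∀ i : Fin n, r ≤ i.val → P i = 0 ∧ Q i = 0) ∧
  LinearIndependent ℚ ![fun i => (P i : ℚ), fun i => (Q i : ℚ)] ∧
  ∀ j : Fin n, j.val < r → ∀ L : Fin n → ℕ,
    IsResonance lam j L ↔ ∃ k : ℕ × ℕ, 1 ≤ k.1 + k.2 ∧ L = Pi.single j 1 + comb P Q k

/-- The exponents `k` with `|k₁ P + k₂ Q| ≥ 2` for which `z ^ (k₁ P + k₂ Q) z_s` has degree less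
than `l` (as `P, Q ≠ 0`, such a `k` has `k₁, k₂ < l`). -/
def exponents {n : ℕ} (P Q : Fin n → ℕ) (l : ℕ) : Finset (ℕ × ℕ) :=
  (Finset.range l ×ˢ Finset.range l).filter
    fun k => 2 ≤ len (comb P Q k) ∧ len (comb P Q k) + 1 < l

/-- `Ft` is in Poincaré–Dulac normal form in the first `r` coordinates up to order `l`, with
coefficients `a k s` of `z ^ (k₁ P + k₂ Q) z_s e_s`:
`Ft z = D z + ∑_{s ≤ r} ∑_k a k s z ^ (k₁ P + k₂ Q) z_s e_s + ∑_{s > r} R_s e_s + O(‖z‖ ^ l)` with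
`D = Diag lam` and `R_s = O(‖z‖ ^ 2)`. -/
def IsNormalFormUpTo {n : ℕ} (Ft : (Fin n → ℂ) → (Fin n → ℂ)) (lam : Fin n → ℂ) (r : ℕ)
    (P Q : Fin n → ℕ) (a : ℕ × ℕ → Fin n → ℂ) (l : ℕ) : Prop :=
  (∀ s : Fin n, s.val < r →
    (fun z : Fin n → ℂ =>
      Ft z s - (lam s * z s + ∑ k ∈ exponents P Q l, a k s * mono z (comb P Q k) * z s))
      =O[𝓝 0] fun z => ‖z‖ ^ l) ∧
  ∀ s : Fin n, r ≤ s.val → (fun z : Fin n → ℂ => Ft z s - lam s * z s) =O[𝓝 0] fun z => ‖z‖ ^ 2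

/-- `F` has weighted order `k₀ < ∞`, and the `a k s` with `k₁ + k₂ = k₀` are the coefficients of
weight `k₀` in some approximate Poincaré–Dulac normal form of `F`: a holomorphic change of
coordinates `ψ` takes `F` to a germ `Ft` in normal form up to an order `l` that is large enough to
see all the terms of weight at most `k₀`, the coefficients of weight less than `k₀` vanish, and some
coefficient of weight `k₀` does not. -/
def IsShadowData {n : ℕ} (F : (Fin n → ℂ) → (Fin n → ℂ)) (lam : Fin n → ℂ) (r : ℕ)
    (P Q : Fin n → ℕ) (k₀ : ℕ) (a : ℕ × ℕ → Fin n → ℂ) : Prop :=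
  1 ≤ k₀ ∧
  (∃ (l : ℕ) (ψ Ft : (Fin n → ℂ) → (Fin n → ℂ)),
    (∀ k : ℕ × ℕ, k.1 + k.2 ≤ k₀ → len (comb P Q k) + 1 < l) ∧
    IsGermBiholo ψ ∧ IsGermBiholo Ft ∧ (∀ᶠ z in 𝓝 0, ψ (F z) = Ft (ψ z)) ∧
    IsNormalFormUpTo Ft lam r P Q a l) ∧
  (∀ k : ℕ × ℕ, 1 ≤ k.1 + k.2 → k.1 + k.2 < k₀ → ∀ s : Fin n, s.val < r → a k s = 0) ∧
  ∃ k : ℕ × ℕ, k.1 + k.2 = k₀ ∧ ∃ s : Fin n, s.val < r ∧ a k s ≠ 0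

/-- `∑_{k₁ + k₂ = k₀} (a k j / lam j) u₁ ^ k₁ u₂ ^ k₂`. -/
def fiberTerm {n : ℕ} (lam : Fin n → ℂ) (k₀ : ℕ) (a : ℕ × ℕ → Fin n → ℂ) (j : Fin n)
    (u : ℂ × ℂ) : ℂ :=
  ∑ k ∈ Finset.HasAntidiagonal.antidiagonal k₀, a k j / lam j * u.1 ^ k.1 * u.2 ^ k.2

/-- The homogeneous map `H_{k₀+1}` of degree `k₀ + 1` of `ℂ²`; the parabolic shadow with data
`k₀`, `a` is `f u = u + H_{k₀+1} u`. -/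
def shadowTerm {n : ℕ} (lam : Fin n → ℂ) (r : ℕ) (P Q : Fin n → ℕ) (k₀ : ℕ)
    (a : ℕ × ℕ → Fin n → ℂ) (u : ℂ × ℂ) : ℂ × ℂ :=
  (u.1 * ∑ k ∈ Finset.HasAntidiagonal.antidiagonal k₀,
      (∑ j : Fin n with j.val < r, (P j : ℂ) * (a k j / lam j)) * u.1 ^ k.1 * u.2 ^ k.2,
   u.2 * ∑ k ∈ Finset.HasAntidiagonal.antidiagonal k₀,
      (∑ j : Fin n with j.val < r, (Q j : ℂ) * (a k j / lam j)) * u.1 ^ k.1 * u.2 ^ k.2)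

/-- `v` is a normalized non-degenerate characteristic direction of `id + H`, where `H` is
homogeneous of degree `k₀ + 1`. -/
def IsNormalizedDirection (H : ℂ × ℂ → ℂ × ℂ) (k₀ : ℕ) (v : ℂ × ℂ) : Prop :=
  v ≠ 0 ∧ H v = (-(1 / (k₀ : ℂ))) • v

/-- The direction `(1, u₀)` is irregular for `id + H`, `H = (Q₁, Q₂)`: the (finite) orders of
vanishing `μ₁`, `μ₂` at `u₀` of `g₁ u = Q₁ (1, u)` and `g₂ u = Q₂ (1, u) - u Q₁ (1, u)` satisfy
`μ₂ > μ₁ + 1`. -/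
def IsIrregularAt (H : ℂ × ℂ → ℂ × ℂ) (u₀ : ℂ) : Prop :=
  analyticOrderAt (fun u : ℂ => (H (1, u)).2 - u * (H (1, u)).1) u₀ ≠ ⊤ ∧
  analyticOrderAt (fun u : ℂ => (H (1, u)).1) u₀ + 1 <
    analyticOrderAt (fun u : ℂ => (H (1, u)).2 - u * (H (1, u)).1) u₀

/-- The direction `[v]` is irregular for `id + H`. The direction `[0 : 1]` is treated by exchanging
the two coordinates of `ℂ²`. -/
def IsIrregularDirection (H : ℂ × ℂ → ℂ × ℂ) (v : ℂ × ℂ) : Prop :=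
  (v.1 ≠ 0 ∧ IsIrregularAt H (v.2 / v.1)) ∨
  (v.1 = 0 ∧ v.2 ≠ 0 ∧ IsIrregularAt (fun w => (H w.swap).swap) 0)

/-- `F` is `(f, v)`-irregular-nondegenerate, for the parabolic shadow `f` with data `k₀`, `a`. -/
def IsIrregularNondegenerate {n : ℕ} (lam : Fin n → ℂ) (r : ℕ) (P Q : Fin n → ℕ) (k₀ : ℕ)
    (a : ℕ × ℕ → Fin n → ℂ) (v : ℂ × ℂ) : Prop :=
  IsNormalizedDirection (shadowTerm lam r P Q k₀ a) k₀ v ∧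
  IsIrregularDirection (shadowTerm lam r P Q k₀ a) v

/-- `F` is `(f, v)`-parabolically-attracting with respect to the first `r` eigenvalues, for the
parabolic shadow `f` with data `k₀`, `a`. -/
def IsParabolicallyAttracting {n : ℕ} (lam : Fin n → ℂ) (r : ℕ) (P Q : Fin n → ℕ) (k₀ : ℕ)
    (a : ℕ × ℕ → Fin n → ℂ) (v : ℂ × ℂ) : Prop :=
  IsNormalizedDirection (shadowTerm lam r P Q k₀ a) k₀ v ∧
  ∀ j : Fin n, j.val < r → (fiberTerm lam k₀ a j v).re < 0

/-- `V` is a basin of attraction of `F` at the origin with the origin on its boundary. -/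
def IsBasinAtBoundary {n : ℕ} (F : (Fin n → ℂ) → (Fin n → ℂ)) (V : Set (Fin n → ℂ)) : Prop :=
  IsOpen V ∧ V.Nonempty ∧ (0 : Fin n → ℂ) ∈ frontier V ∧ Set.MapsTo F V V ∧
    ∀ z ∈ V, Tendsto (fun m : ℕ => F^[m] z) atTop (𝓝 0)

end TwoResonant

end

/-!
Write `x = z ^ P` and `y = z ^ Q`. As the resonances are generated by `P` and `Q`, removing the
non-resonant terms up to a high order `l` gives coordinates in which `F` multiplies `z_j`, `j ≤ r`,
by `lam j * (1 + fiberTerm j (x, y))` up to errors of higher order in `(x, y)` and errors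
`O(‖z‖ ^ l)`. Hence `(x, y)` moves by the parabolic shadow up to similar errors. In the blow-up of
`ℂ²` at the origin, near the direction `[v]`, the shadow is asymptotic to
`(x, y) ↦ (x - x ^ (k + 1) / k, y + C * x ^ k * y ^ (σ + 1))`, and irregularity gives `σ ≥ 1`. The
Fatou coordinates `x ^ (-k)` and `abelCoord σ C y` are then almost translated by `1` and by `x ^ k`,
so that a petal, where both are large and `x` is negligible with respect to a power of `y`, is
preserved, even by a map with errors of higher order in `x`.

The errors `O(‖z‖ ^ l)` are of this kind in the region `‖z‖ ^ N < ‖x‖` as soon as `l` is large with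
respect to `N`. This region is preserved as well. Indeed, in the first `r` coordinates `‖z_j‖` is
multiplied by about `1 + Re (x ^ k * fiberTerm j v)`, which the attracting condition keeps below
`1 - c * ‖x‖ ^ k` while `x ^ k` stays in a thin sector around the positive axis, and then
`‖z_j‖ ^ N` decreases faster than `‖x‖` if `N` is large; the other coordinates decrease
geometrically. Finally `x → 0` along the orbits, and hence `z → 0`.
-/

noncomputable section

namespace TwoResonant

section Orders

variable {E : Type*} [NormedAddCommGroup E]

theorem isBigO_norm_pow_of_le {a b : ℕ} (h : a ≤ b) :
    (fun z : E => ‖z‖ ^ b) =O[𝓝 0] fun z => ‖z‖ ^ a := by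
  obtain rfl | h := h.eq_or_lt
  · exact isBigO_refl _ _
  · exact (isLittleO_norm_pow_norm_pow h).isBigO

theorem isBigO_norm_of_analyticAt [NormedSpace ℂ E] {G : Type*} [NormedAddCommGroup G]
    [NormedSpace ℂ G] {f : E → G} (hf : AnalyticAt ℂ f 0) (h0 : f 0 = 0) :
    f =O[𝓝 0] fun z => ‖z‖ := by
  simpa [h0] using! hf.differentiableAt.isBigO_sub.norm_right

theorem eq_zero_of_isBigO_norm_pow {G : Type*} [NormedAddCommGroup G] {f : E → G} {k : ℕ}
    (h : f =O[𝓝 0] fun z => ‖z‖ ^ k) (hk : k ≠ 0) : f 0 = 0 :=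
  IsBigO.eq_zero_of_norm_pow (by simpa only [sub_zero] using h) hk

theorem prod_isBigO_norm_pow {ι : Type*} (s : Finset ι) {f : ι → E → ℂ} {e : ι → ℕ}
    (hf : ∀ i, f i =O[𝓝 0] fun z => ‖z‖ ^ e i) :
    (fun z => ∏ i ∈ s, f i z) =O[𝓝 0] fun z => ‖z‖ ^ ∑ i ∈ s, e i := by
  simpa only [Finset.prod_pow_eq_pow_sum] using IsBigO.finsetProd (s := s) fun i _ => hf i

theorem prod_sub_prod_isBigO_norm_pow {ι : Type*} (s : Finset ι) {f g : ι → E → ℂ} {e : ι → ℕ}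
    (hf : ∀ i, f i =O[𝓝 0] fun z => ‖z‖ ^ e i) (hg : ∀ i, g i =O[𝓝 0] fun z => ‖z‖ ^ e i)
    (hfg : ∀ i, (fun z => f i z - g i z) =O[𝓝 0] fun z => ‖z‖ ^ (e i + 1)) :
    (fun z => ∏ i ∈ s, f i z - ∏ i ∈ s, g i z) =O[𝓝 0] fun z => ‖z‖ ^ (∑ i ∈ s, e i + 1) := by
  classical
  induction s using Finset.induction_on with
  | empty => simpa using isBigO_zero (fun z : E => ‖z‖) (𝓝 0)
  | insert a s ha ih =>
    simp only [Finset.prod_insert ha, Finset.sum_insert ha]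
    have hfirst := (hfg a).mul (prod_isBigO_norm_pow s hf)
    have hrest := (hg a).mul ih
    simp only [← pow_add] at hfirst hrest
    rw [add_right_comm] at hfirst
    rw [← add_assoc] at hrest
    exact (hfirst.add hrest).congr_left fun z => by ring

end Orders

section Monomials

variable {n : ℕ}

theorem mono_zero {L : Fin n → ℕ} (h : L ≠ 0) : mono (0 : Fin n → ℂ) L = 0 := by
  obtain ⟨i, hi⟩ := Function.ne_iff.1 h
  exact Finset.prod_eq_zero (Finset.mem_univ i) (zero_pow hi)

theorem mono_add (z : Fin n → ℂ) (L M : Fin n → ℕ) : mono z (L + M) = mono z L * mono z M := by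
  simp [mono, pow_add, Finset.prod_mul_distrib]

theorem mono_mul (z w : Fin n → ℂ) (L : Fin n → ℕ) :
    mono (z * w) L = mono z L * mono w L := by
  simp [mono, mul_pow, Finset.prod_mul_distrib]

theorem mono_smul (z : Fin n → ℂ) (m : ℕ) (L : Fin n → ℕ) : mono z (m • L) = mono z L ^ m := by
  simp only [mono, Pi.smul_apply, smul_eq_mul, ← Finset.prod_pow, ← pow_mul, mul_comm m]

theorem mono_single (z : Fin n → ℂ) (j : Fin n) : mono z (Pi.single j 1) = z j := by
  rw [mono, Finset.prod_eq_single j (fun i _ hi => by simp [hi]) (by simp), Pi.single_eq_same,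
    pow_one]

theorem mono_comb (z : Fin n → ℂ) (P Q : Fin n → ℕ) (k : ℕ × ℕ) :
    mono z (comb P Q k) = mono z P ^ k.1 * mono z Q ^ k.2 := by
  rw [comb, mono_add, mono_smul, mono_smul]

theorem analyticAt_mono (L : Fin n → ℕ) (w : Fin n → ℂ) :
    AnalyticAt ℂ (fun w : Fin n → ℂ => mono w L) w :=
  Finset.analyticAt_fun_prod _ fun i _ =>
    ((ContinuousLinearMap.proj (R := ℂ) (φ := fun _ : Fin n => ℂ) i).analyticAt w).pow _

theorem mono_isBigO {E : Type*} [NormedAddCommGroup E] {f : E → Fin n → ℂ}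
    (hf : f =O[𝓝 0] fun z => ‖z‖) (L : Fin n → ℕ) :
    (fun z => mono (f z) L) =O[𝓝 0] fun z => ‖z‖ ^ len L :=
  prod_isBigO_norm_pow Finset.univ fun i => ((isBigO_pi.1 hf) i).pow (L i)

theorem mono_sub_mono_isBigO {E : Type*} [NormedAddCommGroup E] {f g : E → Fin n → ℂ}
    (hf : f =O[𝓝 0] fun z => ‖z‖) (hg : g =O[𝓝 0] fun z => ‖z‖)
    (hfg : (fun z => f z - g z) =O[𝓝 0] fun z => ‖z‖ ^ 2) (L : Fin n → ℕ) :
    (fun z => mono (f z) L - mono (g z) L) =O[𝓝 0] fun z => ‖z‖ ^ (len L + 1) := by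
  refine prod_sub_prod_isBigO_norm_pow Finset.univ (fun i => ((isBigO_pi.1 hf) i).pow (L i))
    (fun i => ((isBigO_pi.1 hg) i).pow (L i)) fun i => ?_
  simpa using prod_sub_prod_isBigO_norm_pow (Finset.range (L i)) (e := fun _ => 1)
    (f := fun _ z => f z i) (g := fun _ z => g z i) (by simpa using (isBigO_pi.1 hf) i)
    (by simpa using (isBigO_pi.1 hg) i) fun _ => (isBigO_pi.1 hfg) i

theorem len_add (L M : Fin n → ℕ) : len (L + M) = len L + len M := Finset.sum_add_distrib

theorem len_single (j : Fin n) : len (Pi.single j 1 : Fin n → ℕ) = 1 := by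
  simp [len]

theorem len_comb (P Q : Fin n → ℕ) (k : ℕ × ℕ) :
    len (comb P Q k) = k.1 * len P + k.2 * len Q := by
  simp [len, comb, Finset.sum_add_distrib, Finset.mul_sum]

theorem len_pos {L : Fin n → ℕ} (h : L ≠ 0) : 1 ≤ len L := by
  obtain ⟨i, hi⟩ := Function.ne_iff.1 h
  exact (Nat.one_le_iff_ne_zero.2 hi).trans
    (Finset.single_le_sum (fun _ _ => Nat.zero_le _) (Finset.mem_univ i))

end Monomials

section HomogeneousPolynomials

variable {n l : ℕ}

/-- The homogeneous polynomial of degree `l` with coefficients `c`. -/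
def homogPoly (l : ℕ) (c : (Fin n → ℕ) → ℂ) (z : Fin n → ℂ) : ℂ :=
  ∑ L ∈ Finset.univ.piAntidiag l, c L * mono z L

theorem mem_piAntidiag_univ_iff_len {L : Fin n → ℕ} :
    L ∈ Finset.univ.piAntidiag l ↔ len L = l := by
  simp [len]

theorem analyticAt_homogPoly (c : (Fin n → ℕ) → ℂ) (w : Fin n → ℂ) :
    AnalyticAt ℂ (homogPoly l c) w :=
  Finset.analyticAt_fun_sum _ fun L _ => analyticAt_const.mul (analyticAt_mono L w)

theorem homogPoly_isBigO {E : Type*} [NormedAddCommGroup E] {f : E → Fin n → ℂ}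
    (hf : f =O[𝓝 0] fun z => ‖z‖) (c : (Fin n → ℕ) → ℂ) :
    (fun z => homogPoly l c (f z)) =O[𝓝 0] fun z => ‖z‖ ^ l := by
  refine IsBigO.fun_sum fun L hL => IsBigO.const_mul_left ?_ _
  simpa only [mem_piAntidiag_univ_iff_len.1 hL] using mono_isBigO hf L

theorem homogPoly_sub_homogPoly_isBigO {E : Type*} [NormedAddCommGroup E]
    {f g : E → Fin n → ℂ} (hf : f =O[𝓝 0] fun z => ‖z‖) (hg : g =O[𝓝 0] fun z => ‖z‖)
    (hfg : (fun z => f z - g z) =O[𝓝 0] fun z => ‖z‖ ^ 2) (c : (Fin n → ℕ) → ℂ) :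
    (fun z => homogPoly l c (f z) - homogPoly l c (g z)) =O[𝓝 0] fun z => ‖z‖ ^ (l + 1) := by
  simp only [homogPoly, ← Finset.sum_sub_distrib, ← mul_sub]
  refine IsBigO.fun_sum fun L hL => IsBigO.const_mul_left ?_ _
  simpa only [mem_piAntidiag_univ_iff_len.1 hL] using mono_sub_mono_isBigO hf hg hfg L

theorem exists_homogPoly_eq_multilinear
    (p : ContinuousMultilinearMap ℂ (fun _ : Fin l => Fin n → ℂ) ℂ) :
    ∃ c, ∀ z, homogPoly l c z = p fun _ => z := by
  let count (g : Fin l → Fin n) (j : Fin n) : ℕ := (Finset.univ.filter fun i => g i = j).card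
  have hcount (g) : count g ∈ Finset.univ.piAntidiag l := by
    rw [mem_piAntidiag_univ_iff_len]
    simpa using! (Finset.card_eq_sum_card_fiberwise (f := g) (s := Finset.univ)
      (t := Finset.univ) fun _ _ => Finset.mem_coe.2 (Finset.mem_univ _)).symm
  have hmono (z g) : mono z (count g) = ∏ i, z (g i) := by
    rw [← Finset.prod_fiberwise (s := Finset.univ) (g := g)]
    refine Finset.prod_congr rfl fun j _ => ?_
    rw [Finset.prod_congr rfl fun i hi => by rw [(Finset.mem_filter.1 hi).2], Finset.prod_const]
  refine ⟨fun L => ∑ g with count g = L, p fun i => Pi.single (g i) 1, fun z => ?_⟩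
  calc homogPoly l _ z
      = ∑ L ∈ Finset.univ.piAntidiag l,
          ∑ g with count g = L, (p fun i => Pi.single (g i) 1) * ∏ i, z (g i) := by
        refine Finset.sum_congr rfl fun L _ => ?_
        rw [Finset.sum_mul]
        exact Finset.sum_congr rfl fun g hg => by rw [← hmono, (Finset.mem_filter.1 hg).2]
    _ = ∑ g : Fin l → Fin n, p fun i => z (g i) • Pi.single (g i) 1 := by
        rw [Finset.sum_fiberwise_of_maps_to fun g _ => hcount g]
        exact Finset.sum_congr rfl fun g _ => by rw [p.map_smul_univ, smul_eq_mul, mul_comm]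
    _ = p fun _ => z := by
        have hz : (fun _ : Fin l => z) =
            fun _ => ∑ j, z j • (Pi.single j (1 : ℂ) : Fin n → ℂ) :=
          funext fun _ => pi_eq_sum_univ' z
        rw [hz, p.map_sum]

theorem exists_sub_homogPoly_isBigO {f : (Fin n → ℂ) → ℂ} (hf : AnalyticAt ℂ f 0)
    (hO : f =O[𝓝 0] fun z => ‖z‖ ^ l) :
    ∃ c, (fun z => f z - homogPoly l c z) =O[𝓝 0] fun z => ‖z‖ ^ (l + 1) := by
  obtain ⟨p, hp⟩ := hf
  have hzero : ∀ k < l, ∀ z, (p k fun _ => z) = 0 := by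
    intro k
    induction k using Nat.strong_induction_on with
    | _ k ih =>
      intro hk
      have hsum : (fun z => p.partialSum (k + 1) z) =O[𝓝 0] fun z => ‖z‖ ^ (k + 1) := by
        simpa using (hO.trans (isBigO_norm_pow_of_le hk)).sub
          (hp.isBigO_sub_partialSum_pow (k + 1))
      refine IsBigO.continuousMultilinearMap_apply_eq_zero (hsum.congr_left fun z => ?_)
      rw [FormalMultilinearSeries.partialSum, Finset.sum_range_succ, Finset.sum_eq_zero, zero_add]
      exact fun i hi => ih i (Finset.mem_range.1 hi) ((Finset.mem_range.1 hi).trans hk) z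
  obtain ⟨c, hc⟩ := exists_homogPoly_eq_multilinear (p l)
  refine ⟨c, (hp.isBigO_sub_partialSum_pow (l + 1)).congr_left fun z => ?_⟩
  rw [hc, FormalMultilinearSeries.partialSum, Finset.sum_range_succ,
    Finset.sum_eq_zero fun i hi => hzero i (Finset.mem_range.1 hi) z, zero_add, zero_add]

end HomogeneousPolynomials

section HomologicalEquation

variable {n l k₀ : ℕ}

/-- The pair of generating resonant monomials: it semiconjugates a resonant map to its shadow. -/
def resMono (P Q : Fin n → ℕ) (w : Fin n → ℂ) : ℂ × ℂ := (mono w P, mono w Q)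

theorem analyticAt_resMono (P Q : Fin n → ℕ) (w : Fin n → ℂ) :
    AnalyticAt ℂ (resMono P Q) w := (analyticAt_mono P w).prod (analyticAt_mono Q w)

theorem resMono_zero {P Q : Fin n → ℕ} (hP : P ≠ 0) (hQ : Q ≠ 0) : resMono P Q 0 = 0 := by
  simp [resMono, mono_zero hP, mono_zero hQ]

theorem analyticAt_monomial (k : ℕ × ℕ) (u : ℂ × ℂ) :
    AnalyticAt ℂ (fun u : ℂ × ℂ => u.1 ^ k.1 * u.2 ^ k.2) u :=
  (analyticAt_fst.pow _).mul (analyticAt_snd.pow _)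

theorem monomial_isBigO (k : ℕ × ℕ) {m : ℕ} (hm : m ≤ k.1 + k.2) :
    (fun u : ℂ × ℂ => u.1 ^ k.1 * u.2 ^ k.2) =O[𝓝 0] fun u => ‖u‖ ^ m := by
  refine IsBigO.trans ?_ (isBigO_norm_pow_of_le hm)
  simp only [pow_add]
  exact (isBigO_fst_prod'.norm_right.pow _).mul (isBigO_snd_prod'.norm_right.pow _)

/-- The homological equation: a homogeneous term is removed up to its resonant part, which is a
function of the resonant monomials. -/
theorem exists_homological_solution {lam : Fin n → ℂ} {P Q : Fin n → ℕ} {s : Fin n}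
    (hres : ∀ L, len L = l → lam s = mono lam L → ∃ k, L = Pi.single s 1 + comb P Q k)
    (hk₀ : ∀ k : ℕ × ℕ, k.1 + k.2 ≤ k₀ → len (comb P Q k) + 1 < l) (c : (Fin n → ℕ) → ℂ) :
    ∃ (d : (Fin n → ℕ) → ℂ) (ρ : ℂ × ℂ → ℂ), AnalyticAt ℂ ρ 0 ∧
      ρ =O[𝓝 0] (fun u => ‖u‖ ^ (k₀ + 1)) ∧
      ∀ w, homogPoly l c w + homogPoly l d (lam * w) =
        lam s * homogPoly l d w + w s * ρ (resMono P Q w) := by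
  classical
  choose! κ hκ using hres
  let R : Finset (Fin n → ℕ) := (Finset.univ.piAntidiag l).filter fun L => lam s = mono lam L
  have hR : ∀ L ∈ R, L = Pi.single s 1 + comb P Q (κ L) := fun L hL =>
    hκ L (mem_piAntidiag_univ_iff_len.1 (Finset.mem_filter.1 hL).1) (Finset.mem_filter.1 hL).2
  refine ⟨fun L => if lam s = mono lam L then 0 else c L / (lam s - mono lam L),
    fun u => ∑ L ∈ R, c L * (u.1 ^ (κ L).1 * u.2 ^ (κ L).2), ?_, ?_, fun w => ?_⟩
  · exact Finset.analyticAt_fun_sum _ fun L _ => analyticAt_const.mul (analyticAt_monomial _ _)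
  · refine IsBigO.fun_sum fun L hL => IsBigO.const_mul_left (monomial_isBigO _ ?_) _
    by_contra! hlt
    have hlen := congrArg len (hR L hL)
    rw [mem_piAntidiag_univ_iff_len.1 (Finset.mem_filter.1 hL).1, len_add, len_single] at hlen
    have := hk₀ (κ L) (Nat.le_of_lt_succ hlt)
    lia
  · have hresonant : ∀ L ∈ R, w s * (c L * (mono w P ^ (κ L).1 * mono w Q ^ (κ L).2)) =
        c L * mono w L := fun L hL => by
      rw [← mono_comb, mul_left_comm, ← mono_single w s, ← mono_add, ← hR L hL]
    simp only [resMono, Finset.mul_sum, homogPoly]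
    rw [Finset.sum_congr rfl hresonant, Finset.sum_filter, ← Finset.sum_add_distrib,
      ← Finset.sum_add_distrib]
    refine Finset.sum_congr rfl fun L _ => ?_
    rw [mono_mul]
    by_cases hL : lam s = mono lam L
    · simp [hL]
    · have : lam s - mono lam L ≠ 0 := sub_ne_zero.2 hL
      simp only [if_neg hL]
      field_simp
      ring

end HomologicalEquation

section Generators

variable {n r : ℕ} {lam : Fin n → ℂ} {P Q : Fin n → ℕ}

theorem comb_swap (P Q : Fin n → ℕ) (k : ℕ × ℕ) : comb Q P k.swap = comb P Q k :=
  add_comm _ _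

namespace AreGenerators

protected theorem swap (h : AreGenerators lam r P Q) : AreGenerators lam r Q P := by
  refine ⟨fun i hi => (h.1 i hi).symm, LinearIndependent.pair_symm_iff.1 h.2.1,
    fun j hj L => (h.2.2 j hj L).trans ?_⟩
  rw [← (Equiv.prodComm ℕ ℕ).exists_congr_right]
  simp [comb_swap, add_comm]

theorem eq_zero_of_smul_add_smul (h : AreGenerators lam r P Q) {s t : ℚ}
    (hst : ∀ i, s * P i + t * Q i = 0) : s = 0 ∧ t = 0 :=
  LinearIndependent.pair_iff.1 h.2.1 s t (funext fun i => by simpa using hst i)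

theorem left_ne_zero (h : AreGenerators lam r P Q) : P ≠ 0 := by
  rintro rfl
  exact one_ne_zero (h.eq_zero_of_smul_add_smul (s := 1) (t := 0) (by simp)).1

theorem right_ne_zero (h : AreGenerators lam r P Q) : Q ≠ 0 := h.swap.left_ne_zero

theorem exists_lt (h : AreGenerators lam r P Q) : ∃ j : Fin n, j.val < r := by
  obtain ⟨j, hj⟩ := Function.ne_iff.1 h.left_ne_zero
  exact ⟨j, not_le.1 fun hr => hj (h.1 j hr).1⟩

theorem mono_left (h : AreGenerators lam r P Q) {j : Fin n} (hj : j.val < r) (h0 : lam j ≠ 0) :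
    mono lam P = 1 := by
  have hres : lam j = mono lam (Pi.single j 1 + P) :=
    ((h.2.2 j hj _).2 ⟨(1, 0), le_rfl, by simp [comb]⟩).2
  rw [mono_add, mono_single] at hres
  exact (mul_eq_left₀ h0).1 hres.symm

theorem mono_right (h : AreGenerators lam r P Q) {j : Fin n} (hj : j.val < r) (h0 : lam j ≠ 0) :
    mono lam Q = 1 := h.swap.mono_left hj h0

end AreGenerators

theorem exists_eq_single_of_len_eq_one {L : Fin n → ℕ} (h : len L = 1) :
    ∃ i, L = Pi.single i 1 := by
  have hL : L ≠ 0 := by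
    rintro rfl
    simp [len] at h
  obtain ⟨i, hi⟩ := Function.ne_iff.1 hL
  have hsum : L i + ∑ x ∈ Finset.univ.erase i, L x = 1 := by
    rw [Finset.add_sum_erase _ _ (Finset.mem_univ i)]
    exact h
  have hLi : L i ≠ 0 := hi
  refine ⟨i, funext fun x => ?_⟩
  obtain rfl | hx := eq_or_ne x i
  · rw [Pi.single_eq_same]
    lia
  · have hrest : ∑ x ∈ Finset.univ.erase i, L x = 0 := by lia
    rw [Pi.single_eq_of_ne hx, Finset.sum_eq_zero_iff.1 hrest x (by simp [hx])]

namespace AreGenerators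

/-- If `P = e_i`, then `lam i = 1`, so `(i, 2Q)` is a resonance which is not of the required
form. -/
theorem two_le_len_left (h : AreGenerators lam r P Q) {j : Fin n} (hj : j.val < r)
    (h0 : lam j ≠ 0) : 2 ≤ len P := by
  by_contra! hlt
  obtain ⟨i, hP⟩ := exists_eq_single_of_len_eq_one
    (le_antisymm (Nat.le_of_lt_succ hlt) (len_pos h.left_ne_zero))
  have hir : i.val < r := by
    by_contra! hri
    simpa [hP] using (h.1 i hri).1
  have hlam : lam i = 1 := by rw [← h.mono_left hj h0, hP, mono_single]
  have hlen : 2 ≤ len (2 • Q) := by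
    have := len_pos h.right_ne_zero
    have : len (2 • Q) = 2 * len Q := by simp [len, Finset.mul_sum]
    lia
  obtain ⟨k, -, hk⟩ := (h.2.2 i hir (2 • Q)).1
    ⟨hlen, by rw [mono_smul, h.mono_right hj h0, hlam, one_pow]⟩
  have hrel := h.eq_zero_of_smul_add_smul (s := 1 + k.1) (t := k.2 - 2) fun x => by
    have hx := congrFun hk x
    simp only [← hP, comb, Pi.add_apply, Pi.smul_apply, smul_eq_mul] at hx
    have : (2 * Q x : ℚ) = P x + (k.1 * P x + k.2 * Q x) := mod_cast hx
    linarith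
  have : (1 + k.1 : ℚ) ≠ 0 := by positivity
  exact this hrel.1

theorem two_le_len_comb (h : AreGenerators lam r P Q) {j : Fin n} (hj : j.val < r)
    (h0 : lam j ≠ 0) {k : ℕ × ℕ} (hk : 1 ≤ k.1 + k.2) : 2 ≤ len (comb P Q k) := by
  rw [len_comb]
  have := h.two_le_len_left hj h0
  have := h.swap.two_le_len_left hj h0
  nlinarith

end AreGenerators

end Generators

section NormalForm

variable {n r l k₀ : ℕ} {F Φ : (Fin n → ℂ) → (Fin n → ℂ)} {lam : Fin n → ℂ} {P Q : Fin n → ℕ}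
  {q : Fin n → ℂ × ℂ → ℂ} {a : ℕ × ℕ → Fin n → ℂ}

/-- Holomorphic coordinates `Φ`, tangent to the identity, in which `F` is in Poincaré–Dulac normal
form up to order `l` in the first `r` coordinates: the `s`-th one is multiplied by
`lam s + q s (w ^ P, w ^ Q)`. -/
structure IsNormalizingCoord (F : (Fin n → ℂ) → (Fin n → ℂ)) (lam : Fin n → ℂ) (r : ℕ)
    (P Q : Fin n → ℕ) (q : Fin n → ℂ × ℂ → ℂ) (Φ : (Fin n → ℂ) → (Fin n → ℂ)) (l : ℕ) :
    Prop where
  analyticAt : AnalyticAt ℂ Φ 0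
  tangent : (fun z => Φ z - z) =O[𝓝 0] fun z => ‖z‖ ^ 2
  analyticAt_coeff : ∀ s, AnalyticAt ℂ (q s) 0
  coeff_zero : ∀ s, q s 0 = 0
  normal : ∀ s : Fin n, s.val < r →
    (fun z => Φ (F z) s - Φ z s * (lam s + q s (resMono P Q (Φ z)))) =O[𝓝 0] fun z => ‖z‖ ^ l
  contract : ∀ s : Fin n, r ≤ s.val →
    (fun z => Φ (F z) s - lam s * Φ z s) =O[𝓝 0] fun z => ‖z‖ ^ 2

theorem analyticAt_apply {E : Type*} [NormedAddCommGroup E] [NormedSpace ℂ E]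
    {f : E → Fin n → ℂ} {x : E} (hf : AnalyticAt ℂ f x) (s : Fin n) :
    AnalyticAt ℂ (fun z => f z s) x :=
  analyticAt_pi_iff.1 hf s

theorem analyticAt_comp_resMono {g : ℂ × ℂ → ℂ} (hP : P ≠ 0) (hQ : Q ≠ 0)
    (hg : AnalyticAt ℂ g 0) : AnalyticAt ℂ (fun w => g (resMono P Q w)) 0 :=
  hg.comp_of_eq (analyticAt_resMono P Q 0) (resMono_zero hP hQ)

theorem mul_comp_sub_mul_comp_isBigO {E : Type*} [NormedAddCommGroup E] {f g : E → Fin n → ℂ}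
    (hf : f =O[𝓝 0] fun z => ‖z‖) (hg : g =O[𝓝 0] fun z => ‖z‖)
    (hfg : (fun z => f z - g z) =O[𝓝 0] fun z => ‖z‖ ^ l) {h : (Fin n → ℂ) → ℂ}
    (hh : AnalyticAt ℂ h 0) (h0 : h 0 = 0) (s : Fin n) :
    (fun z => f z s * h (f z) - g z s * h (g z)) =O[𝓝 0] fun z => ‖z‖ ^ (l + 1) := by
  have hf0 : Tendsto f (𝓝 0) (𝓝 0) := hf.trans_tendsto tendsto_norm_zero
  have hg0 : Tendsto g (𝓝 0) (𝓝 0) := hg.trans_tendsto tendsto_norm_zero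
  have hhf : (fun z => h (f z)) =O[𝓝 0] fun z => ‖z‖ :=
    ((isBigO_norm_of_analyticAt hh h0).comp_tendsto hf0).trans hf.norm_left
  have hhfg : (fun z => h (f z) - h (g z)) =O[𝓝 0] fun z => ‖z‖ ^ l :=
    (hh.hasStrictFDerivAt.isBigO_sub.comp_tendsto (hf0.prodMk_nhds hg0)).trans hfg
  refine IsBigO.congr_left (((isBigO_pi.1 hfg s).mul hhf).add ?_)
    (f₁ := fun z => (f z - g z) s * h (f z) + g z s * (h (f z) - h (g z))) fun z => ?_
  · simpa only [pow_succ, mul_comm] using (isBigO_pi.1 hg s).mul hhfg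
  · simp only [Pi.sub_apply]
    ring

namespace IsNormalizingCoord

theorem map_zero (h : IsNormalizingCoord F lam r P Q q Φ l) : Φ 0 = 0 := by
  simpa using eq_zero_of_isBigO_norm_pow h.tangent two_ne_zero

theorem isBigO_norm (h : IsNormalizingCoord F lam r P Q q Φ l) : Φ =O[𝓝 0] fun z => ‖z‖ :=
  isBigO_norm_of_analyticAt h.analyticAt h.map_zero

theorem analyticAt_coeff_comp (h : IsNormalizingCoord F lam r P Q q Φ l) (hP : P ≠ 0)
    (hQ : Q ≠ 0) (s : Fin n) : AnalyticAt ℂ (fun w => q s (resMono P Q w)) 0 :=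
  analyticAt_comp_resMono hP hQ (h.analyticAt_coeff s)

theorem comp_sub_mul_isBigO (h : IsNormalizingCoord F lam r P Q q Φ l) (hP : P ≠ 0) (hQ : Q ≠ 0)
    (hl : 2 ≤ l) : (fun z => Φ (F z) - lam * Φ z) =O[𝓝 0] fun z => ‖z‖ ^ 2 := by
  refine isBigO_pi.2 fun s => ?_
  obtain hs | hs := lt_or_ge s.val r
  · have hcoeff := mul_comp_sub_mul_comp_isBigO (g := fun _ => 0) (l := 1) h.isBigO_norm
      (isBigO_zero _ _) (by simpa only [sub_zero, pow_one] using h.isBigO_norm)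
      (h.analyticAt_coeff_comp hP hQ s) (by rw [resMono_zero hP hQ, h.coeff_zero]) s
    refine (((h.normal s hs).trans (isBigO_norm_pow_of_le hl)).add hcoeff).congr_left fun z => ?_
    simp only [Pi.sub_apply, Pi.mul_apply, Pi.zero_apply]
    ring
  · exact h.contract s hs

theorem exists_coord_succ (h : IsNormalizingCoord F lam r P Q q Φ l) (hF : AnalyticAt ℂ F 0)
    (hF0 : F 0 = 0) (hP : P ≠ 0) (hQ : Q ≠ 0) (hl : 2 ≤ l) {s : Fin n} (hs : s.val < r)
    (hres : ∀ L, len L = l → lam s = mono lam L → ∃ k, L = Pi.single s 1 + comb P Q k)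
    (hk₀ : ∀ k : ℕ × ℕ, k.1 + k.2 ≤ k₀ → len (comb P Q k) + 1 < l) :
    ∃ (d : (Fin n → ℕ) → ℂ) (ρ : ℂ × ℂ → ℂ), AnalyticAt ℂ ρ 0 ∧
      ρ =O[𝓝 0] (fun u => ‖u‖ ^ (k₀ + 1)) ∧
      ∀ Ψ : (Fin n → ℂ) → (Fin n → ℂ), (fun z => Ψ z - Φ z) =O[𝓝 0] (fun z => ‖z‖ ^ l) →
        (∀ z, Ψ z s = Φ z s + homogPoly l d (Φ z)) →
        (fun z => Ψ (F z) s - Ψ z s * (lam s + (q s (resMono P Q (Ψ z)) + ρ (resMono P Q (Ψ z)))))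
          =O[𝓝 0] fun z => ‖z‖ ^ (l + 1) := by
  have hΦF : AnalyticAt ℂ (fun z => Φ (F z)) 0 := h.analyticAt.comp_of_eq hF hF0
  have hΦF' : (fun z => Φ (F z)) =O[𝓝 0] fun z => ‖z‖ :=
    isBigO_norm_of_analyticAt hΦF (by rw [hF0, h.map_zero])
  obtain ⟨c, hc⟩ := exists_sub_homogPoly_isBigO
    ((analyticAt_apply hΦF s).sub ((analyticAt_apply h.analyticAt s).mul (analyticAt_const.add
      ((h.analyticAt_coeff_comp hP hQ s).comp_of_eq h.analyticAt h.map_zero)))) (h.normal s hs)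
  obtain ⟨d, ρ, hρ, hρO, hd⟩ := exists_homological_solution hres hk₀ c
  have hρ0 : ρ 0 = 0 := eq_zero_of_isBigO_norm_pow hρO k₀.succ_ne_zero
  refine ⟨d, ρ, hρ, hρO, fun Ψ hΨ hΨs => ?_⟩
  have hΨO : Ψ =O[𝓝 0] fun z => ‖z‖ :=
    ((hΨ.trans (isBigO_norm_pow_of_le (one_le_two.trans hl))).add
      (by simpa using h.isBigO_norm)).congr (fun z => sub_add_cancel _ _) fun z => pow_one _
  have hcΦ := homogPoly_sub_homogPoly_isBigO (l := l) (isBigO_refl _ _).norm_right h.isBigO_norm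
    (h.tangent.neg_left.congr_left fun z => neg_sub _ _) c
  have hdΦ := homogPoly_sub_homogPoly_isBigO (l := l) hΦF'
    (isBigO_pi.2 fun i => ((isBigO_pi.1 h.isBigO_norm) i).const_mul_left (lam i))
    (h.comp_sub_mul_isBigO hP hQ hl) d
  have hcoeff := mul_comp_sub_mul_comp_isBigO hΨO h.isBigO_norm hΨ
    ((h.analyticAt_coeff_comp hP hQ s).add (analyticAt_comp_resMono hP hQ hρ))
    (by simp [resMono_zero hP hQ, h.coeff_zero, hρ0]) s
  refine (((hc.add hcΦ).add hdΦ).sub hcoeff).congr_left fun z => ?_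
  simp only [hΨs, Pi.add_apply, Pi.sub_apply, Pi.mul_apply, Function.comp_apply]
  linear_combination -hd (Φ z)

theorem exists_succ (h : IsNormalizingCoord F lam r P Q q Φ l) (hF : AnalyticAt ℂ F 0)
    (hF0 : F 0 = 0) (hP : P ≠ 0) (hQ : Q ≠ 0) (hl : 2 ≤ l)
    (hres : ∀ s : Fin n, s.val < r → ∀ L, len L = l → lam s = mono lam L →
      ∃ k, L = Pi.single s 1 + comb P Q k)
    (hk₀ : ∀ k : ℕ × ℕ, k.1 + k.2 ≤ k₀ → len (comb P Q k) + 1 < l) :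
    ∃ q' Φ', IsNormalizingCoord F lam r P Q q' Φ' (l + 1) ∧
      ∀ s, (fun u => q' s u - q s u) =O[𝓝 0] fun u => ‖u‖ ^ (k₀ + 1) := by
  choose! d ρ hρ hρO hnormal using fun s hs =>
    h.exists_coord_succ hF hF0 hP hQ hl hs (hres s hs) hk₀
  let q' : Fin n → ℂ × ℂ → ℂ := fun s u => q s u + if s.val < r then ρ s u else 0
  let Φ' : (Fin n → ℂ) → (Fin n → ℂ) := fun z s =>
    Φ z s + if s.val < r then homogPoly l (d s) (Φ z) else 0
  have hΦ' : (fun z => Φ' z - Φ z) =O[𝓝 0] fun z => ‖z‖ ^ l := by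
    refine isBigO_pi.2 fun s => ?_
    by_cases hs : s.val < r
    · simpa [Φ', hs] using homogPoly_isBigO h.isBigO_norm (d s)
    · simpa [Φ', hs] using isBigO_zero _ _
  refine ⟨q', Φ', ⟨analyticAt_pi_iff.2 fun s => ?_, ?_, fun s => ?_, fun s => ?_, fun s hs => ?_,
    fun s hs => ?_⟩, fun s => ?_⟩
  · refine (analyticAt_apply h.analyticAt s).add ?_
    split_ifs
    · exact (analyticAt_homogPoly _ _).comp h.analyticAt
    · exact analyticAt_const
  · exact ((hΦ'.trans (isBigO_norm_pow_of_le hl)).add h.tangent).congr_left fun z => by simp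
  · refine (h.analyticAt_coeff s).add ?_
    split_ifs with hs
    · exact hρ s hs
    · exact analyticAt_const
  · by_cases hs : s.val < r
    · have : ρ s 0 = 0 := eq_zero_of_isBigO_norm_pow (hρO s hs) k₀.succ_ne_zero
      simp [q', h.coeff_zero, this]
    · simp [q', h.coeff_zero, hs]
  · simpa only [q', if_pos hs] using hnormal s hs Φ' hΦ' fun z => by simp [Φ', hs]
  · simpa only [Φ', if_neg hs.not_gt, add_zero] using h.contract s hs
  · by_cases hs : s.val < r
    · simpa [q', hs] using hρO s hs
    · simpa [q', hs] using isBigO_zero _ _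

end IsNormalizingCoord

/-- The part of weight `k₀` of the resonant terms of the `s`-th coordinate. -/
def leadTerm (k₀ : ℕ) (a : ℕ × ℕ → Fin n → ℂ) (s : Fin n) (u : ℂ × ℂ) : ℂ :=
  ∑ k ∈ Finset.HasAntidiagonal.antidiagonal k₀, a k s * (u.1 ^ k.1 * u.2 ^ k.2)

theorem one_le_of_mem_exponents {k : ℕ × ℕ} (hk : k ∈ exponents P Q l) : 1 ≤ k.1 + k.2 := by
  by_contra! hlt
  have h1 : k.1 = 0 := by lia
  have h2 : k.2 = 0 := by lia
  simpa [len_comb, h1, h2] using (Finset.mem_filter.1 hk).2.1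

theorem antidiagonal_subset_exponents (hP : P ≠ 0) (hQ : Q ≠ 0)
    (h2 : ∀ k : ℕ × ℕ, k.1 + k.2 = k₀ → 2 ≤ len (comb P Q k))
    (hk₀ : ∀ k : ℕ × ℕ, k.1 + k.2 = k₀ → len (comb P Q k) + 1 < l) :
    Finset.HasAntidiagonal.antidiagonal k₀ ⊆ exponents P Q l := by
  intro k hk
  rw [Finset.HasAntidiagonal.mem_antidiagonal] at hk
  have hlt := hk₀ k hk
  refine Finset.mem_filter.2 ⟨?_, h2 k hk, hlt⟩
  rw [len_comb] at hlt
  have := len_pos hP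
  have := len_pos hQ
  simp only [Finset.mem_product, Finset.mem_range]
  constructor <;> nlinarith

theorem resonant_sub_leadTerm_isBigO {s : Fin n}
    (hsub : Finset.HasAntidiagonal.antidiagonal k₀ ⊆ exponents P Q l)
    (ha : ∀ k : ℕ × ℕ, 1 ≤ k.1 + k.2 → k.1 + k.2 < k₀ → a k s = 0) :
    (fun u => ∑ k ∈ exponents P Q l, a k s * (u.1 ^ k.1 * u.2 ^ k.2) - leadTerm k₀ a s u)
      =O[𝓝 0] fun u => ‖u‖ ^ (k₀ + 1) := by
  simp only [leadTerm, ← Finset.sum_sdiff hsub, add_sub_cancel_right]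
  refine IsBigO.fun_sum fun k hk => ?_
  obtain ⟨hmem, hne⟩ := Finset.mem_sdiff.1 hk
  rw [Finset.HasAntidiagonal.mem_antidiagonal] at hne
  obtain hlt | hgt := lt_or_gt_of_ne hne
  · simpa [ha k (one_le_of_mem_exponents hmem) hlt] using isBigO_zero _ _
  · exact (monomial_isBigO k hgt).const_mul_left _

theorem IsNormalFormUpTo.isNormalizingCoord_id (h : IsNormalFormUpTo F lam r P Q a l) :
    IsNormalizingCoord F lam r P Q
      (fun s u => ∑ k ∈ exponents P Q l, a k s * (u.1 ^ k.1 * u.2 ^ k.2)) id l where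
  analyticAt := analyticAt_id
  tangent := by simpa using! isBigO_zero (E' := Fin n → ℂ) (fun z : Fin n → ℂ => ‖z‖ ^ 2) (𝓝 0)
  analyticAt_coeff s :=
    Finset.analyticAt_fun_sum _ fun k _ => analyticAt_const.mul (analyticAt_monomial k 0)
  coeff_zero s := by
    refine Finset.sum_eq_zero fun k hk => ?_
    simp only [Prod.fst_zero, Prod.snd_zero, ← pow_add,
      zero_pow (Nat.one_le_iff_ne_zero.1 (one_le_of_mem_exponents hk)), mul_zero]
  normal s hs := by
    refine (h.1 s hs).congr_left fun z => ?_
    simp only [mono_comb, id, resMono, mul_add, Finset.mul_sum]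
    congr 1
    simp only [mul_comm, mul_left_comm]
  contract := h.2

theorem exists_isNormalizingCoord (hF : AnalyticAt ℂ F 0) (hF0 : F 0 = 0)
    (hN : IsNormalFormUpTo F lam r P Q a l) (hgen : AreGenerators lam r P Q)
    (hsub : Finset.HasAntidiagonal.antidiagonal k₀ ⊆ exponents P Q l)
    (hk₀ : ∀ k : ℕ × ℕ, k.1 + k.2 ≤ k₀ → len (comb P Q k) + 1 < l)
    (ha : ∀ k : ℕ × ℕ, 1 ≤ k.1 + k.2 → k.1 + k.2 < k₀ → ∀ s : Fin n, s.val < r → a k s = 0)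
    (m : ℕ) :
    ∃ q Φ, IsNormalizingCoord F lam r P Q q Φ (l + m) ∧ ∀ s : Fin n, s.val < r →
      (fun u => q s u - leadTerm k₀ a s u) =O[𝓝 0] fun u => ‖u‖ ^ (k₀ + 1) := by
  have hl : 2 ≤ l := by
    have := hk₀ (0, 0) k₀.zero_le
    lia
  induction m with
  | zero =>
    exact ⟨_, id, hN.isNormalizingCoord_id, fun s hs =>
      resonant_sub_leadTerm_isBigO hsub fun k h1 hlt => ha k h1 hlt s hs⟩
  | succ m ih =>
    obtain ⟨q, Φ, hΦ, hq⟩ := ih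
    have hres (s : Fin n) (hs : s.val < r) (L : Fin n → ℕ) (hL : len L = l + m)
        (hlam : lam s = mono lam L) : ∃ k, L = Pi.single s 1 + comb P Q k := by
      obtain ⟨k, -, hk⟩ := (hgen.2.2 s hs L).1 ⟨by lia, hlam⟩
      exact ⟨k, hk⟩
    obtain ⟨q', Φ', hΦ', hq'⟩ := hΦ.exists_succ hF hF0 hgen.left_ne_zero hgen.right_ne_zero
      (by lia) hres fun k hk => (hk₀ k hk).trans_le (by lia)
    exact ⟨q', Φ', hΦ', fun s hs => ((hq' s).add (hq s hs)).congr_left fun u => by ring⟩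

end NormalForm

section SmallFactors

variable {α : Type*} {𝓕 : Filter α} {g : α → ℝ}

theorem mul_sub_one_add_isBigO {A B a b : α → ℂ} (hg : g =O[𝓕] fun _ => (1 : ℝ))
    (hA : (fun x => A x - (1 + a x)) =O[𝓕] fun x => g x ^ 2) (ha : a =O[𝓕] g)
    (hB : (fun x => B x - (1 + b x)) =O[𝓕] fun x => g x ^ 2) (hb : b =O[𝓕] g) :
    (fun x => A x * B x - (1 + (a x + b x))) =O[𝓕] fun x => g x ^ 2 := by
  have hone : (fun _ => (1 : ℂ)) =O[𝓕] fun _ => (1 : ℝ) := isBigO_const_const _ one_ne_zero _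
  have hbnd : B =O[𝓕] fun _ => (1 : ℝ) :=
    ((hB.trans ((hg.pow 2).congr_right fun _ => one_pow 2)).add
      (hone.add (hb.trans hg))).congr_left fun x => by ring
  have hAB : (fun x => (A x - (1 + a x)) * B x) =O[𝓕] fun x => g x ^ 2 := by
    simpa using! hA.mul hbnd
  have haB : (fun x => (1 + a x) * (B x - (1 + b x))) =O[𝓕] fun x => g x ^ 2 := by
    simpa using! (hone.add (ha.trans hg)).mul hB
  have hab : (fun x => a x * b x) =O[𝓕] fun x => g x ^ 2 := by
    simpa only [pow_two] using ha.mul hb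
  exact ((hAB.add haB).add hab).congr_left fun x => by ring

theorem pow_one_add_isBigO {a : α → ℂ} (hg : g =O[𝓕] fun _ => (1 : ℝ)) (ha : a =O[𝓕] g) (m : ℕ) :
    (fun x => (1 + a x) ^ m - (1 + m * a x)) =O[𝓕] fun x => g x ^ 2 := by
  induction m with
  | zero => simpa using isBigO_zero _ _
  | succ m ih =>
    have hfactor : (fun x => 1 + a x - (1 + a x)) =O[𝓕] fun x => g x ^ 2 :=
      (isBigO_zero _ _).congr_left fun x => (sub_self _).symm
    refine (mul_sub_one_add_isBigO hg ih (ha.const_mul_left _) hfactor ha).congr_left fun x => ?_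
    push_cast
    ring

theorem mono_one_add_isBigO {n : ℕ} {L : Fin n → ℕ} {ζ : α → Fin n → ℂ}
    (hg : g =O[𝓕] fun _ => (1 : ℝ)) (hζ : ∀ j, L j ≠ 0 → (fun x => ζ x j) =O[𝓕] g) :
    (fun x => mono (1 + ζ x) L - (1 + ∑ j, L j * ζ x j)) =O[𝓕] fun x => g x ^ 2 := by
  classical
  have hsmall (j) : (fun x => L j * ζ x j) =O[𝓕] g := by
    by_cases hj : L j = 0
    · simpa [hj] using isBigO_zero _ _
    · exact (hζ j hj).const_mul_left _
  have hpow (j) : (fun x => (1 + ζ x j) ^ L j - (1 + L j * ζ x j)) =O[𝓕] fun x => g x ^ 2 := by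
    by_cases hj : L j = 0
    · simpa [hj] using isBigO_zero _ _
    · exact pow_one_add_isBigO hg (hζ j hj) _
  have hprod (s : Finset (Fin n)) : (fun x => ∏ j ∈ s, (1 + ζ x j) ^ L j -
      (1 + ∑ j ∈ s, L j * ζ x j)) =O[𝓕] fun x => g x ^ 2 := by
    induction s using Finset.induction_on with
    | empty => simpa using isBigO_zero _ _
    | insert i s hi ih =>
      simp only [Finset.prod_insert hi, Finset.sum_insert hi]
      exact mul_sub_one_add_isBigO hg (hpow i) (hsmall i) ih (IsBigO.fun_sum fun j _ => hsmall j)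
  exact hprod Finset.univ

theorem isBigO_add_of_nonneg {f₁ f₂ : α → ℂ} {g₁ g₂ : α → ℝ} (h₁ : f₁ =O[𝓕] g₁)
    (h₂ : f₂ =O[𝓕] g₂) (hg₁ : ∀ x, 0 ≤ g₁ x) (hg₂ : ∀ x, 0 ≤ g₂ x) :
    (fun x => f₁ x + f₂ x) =O[𝓕] fun x => g₁ x + g₂ x := by
  refine (h₁.trans (.of_norm_le fun x => ?_)).add (h₂.trans (.of_norm_le fun x => ?_))
  · rw [Real.norm_of_nonneg (hg₁ x)]
    exact le_add_of_nonneg_right (hg₂ x)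
  · rw [Real.norm_of_nonneg (hg₂ x)]
    exact le_add_of_nonneg_left (hg₁ x)

end SmallFactors

section ShadowCoordinates

variable {n r k l : ℕ} {F Φ : (Fin n → ℂ) → (Fin n → ℂ)} {lam : Fin n → ℂ} {P Q L : Fin n → ℕ}
  {q fib : Fin n → ℂ × ℂ → ℂ}

/-- The increment, to first order in `fib`, of `(z ^ P, z ^ Q)` when the `j`-th coordinate is
multiplied by `1 + fib j (z ^ P, z ^ Q)`: the parabolic shadow minus the identity. -/
def shadowMap (P Q : Fin n → ℕ) (fib : Fin n → ℂ × ℂ → ℂ) (u : ℂ × ℂ) : ℂ × ℂ :=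
  (u.1 * ∑ j, P j * fib j u, u.2 * ∑ j, Q j * fib j u)

/-- Local coordinates `Φ` in which `F` multiplies the `j`-th coordinate, `j ≤ r`, by
`lam j * (1 + fib j (w ^ P, w ^ Q))`, and hence moves `(w ^ P, w ^ Q)` by `shadowMap P Q fib`, up to
terms of higher order in `(w ^ P, w ^ Q)` and errors `O(‖w‖ ^ l)`. -/
structure IsShadowCoord (F : (Fin n → ℂ) → (Fin n → ℂ)) (lam : Fin n → ℂ) (r : ℕ)
    (P Q : Fin n → ℕ) (fib : Fin n → ℂ × ℂ → ℂ) (k l : ℕ)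
    (Φ : (Fin n → ℂ) → (Fin n → ℂ)) : Prop where
  map_zero : Φ 0 = 0
  continuousAt : ∀ᶠ z in 𝓝 0, ContinuousAt Φ z
  nhds_le_map : 𝓝 0 ≤ map Φ (𝓝 0)
  id_isBigO : id =O[𝓝 0] Φ
  base : (fun z => resMono P Q (Φ (F z)) - (resMono P Q (Φ z) +
    shadowMap P Q fib (resMono P Q (Φ z)))) =O[𝓝 0]
      fun z => ‖resMono P Q (Φ z)‖ ^ (k + 2) + ‖Φ z‖ ^ l
  fiber : ∀ j : Fin n, j.val < r →
    (fun z => Φ (F z) j - lam j * (Φ z j * (1 + fib j (resMono P Q (Φ z))))) =O[𝓝 0]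
      fun z => ‖Φ z‖ * ‖resMono P Q (Φ z)‖ ^ (k + 1) + ‖Φ z‖ ^ l
  contract : ∀ j : Fin n, r ≤ j.val →
    (fun z => Φ (F z) j - lam j * Φ z j) =O[𝓝 0] fun z => ‖Φ z‖ ^ 2

namespace IsGermBiholo

variable {ψ : (Fin n → ℂ) → (Fin n → ℂ)}

theorem tendsto (hψ : IsGermBiholo ψ) : Tendsto ψ (𝓝 0) (𝓝 0) := by
  simpa [ContinuousAt, hψ.1] using hψ.2.1.continuousAt

theorem nhds_le_map (hψ : IsGermBiholo ψ) : 𝓝 0 ≤ map ψ (𝓝 0) := by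
  obtain ⟨-, -, G, hG0, hG, -, hψG⟩ := hψ
  have hGt : Tendsto G (𝓝 0) (𝓝 0) := by simpa [ContinuousAt, hG0] using hG.continuousAt
  calc 𝓝 0 = map (ψ ∘ G) (𝓝 0) := (map_id.symm.trans (Filter.map_congr hψG).symm)
    _ ≤ map ψ (𝓝 0) := map_map.symm.trans_le (map_mono hGt)

theorem id_isBigO (hψ : IsGermBiholo ψ) : id =O[𝓝 0] ψ := by
  obtain ⟨G, hG0, hG, hGψ, -⟩ := hψ.2.2
  exact ((isBigO_norm_right.1 (isBigO_norm_of_analyticAt hG hG0)).comp_tendsto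
    hψ.tendsto).congr' hGψ .rfl

end IsGermBiholo

theorem IsShadowCoord.comp {Ft ψ : (Fin n → ℂ) → (Fin n → ℂ)}
    (h : IsShadowCoord Ft lam r P Q fib k l Φ) (hψ : IsGermBiholo ψ)
    (hconj : ∀ᶠ z in 𝓝 0, ψ (F z) = Ft (ψ z)) :
    IsShadowCoord F lam r P Q fib k l (Φ ∘ ψ) where
  map_zero := by rw [Function.comp, hψ.1, h.map_zero]
  continuousAt := by
    filter_upwards [hψ.tendsto.eventually h.continuousAt, hψ.2.1.eventually_analyticAt]
      with z hΦ hz using hΦ.comp hz.continuousAt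
  nhds_le_map := by
    rw [← map_map]
    exact h.nhds_le_map.trans (map_mono hψ.nhds_le_map)
  id_isBigO := hψ.id_isBigO.trans (h.id_isBigO.comp_tendsto hψ.tendsto)
  base := by
    refine (h.base.comp_tendsto hψ.tendsto).congr' ?_ .rfl
    filter_upwards [hconj] with z hz using by simp [hz]
  fiber j hj := by
    refine ((h.fiber j hj).comp_tendsto hψ.tendsto).congr' ?_ .rfl
    filter_upwards [hconj] with z hz using by simp [hz]
  contract j hj := by
    refine ((h.contract j hj).comp_tendsto hψ.tendsto).congr' ?_ .rfl
    filter_upwards [hconj] with z hz using by simp [hz]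

namespace IsNormalizingCoord

theorem hasStrictFDerivAt (h : IsNormalizingCoord F lam r P Q q Φ l) :
    HasStrictFDerivAt Φ
      (ContinuousLinearEquiv.refl ℂ (Fin n → ℂ) : (Fin n → ℂ) →L[ℂ] (Fin n → ℂ)) 0 := by
  have hderiv : HasFDerivAt Φ (ContinuousLinearMap.id ℂ (Fin n → ℂ)) 0 := by
    rw [hasFDerivAt_iff_isLittleO_nhds_zero]
    simpa [h.map_zero] using! h.tangent.trans_isLittleO (isLittleO_norm_pow_id one_lt_two)
  have hstrict := h.analyticAt.hasStrictFDerivAt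
  rwa [hderiv.fderiv] at hstrict

theorem nhds_le_map (h : IsNormalizingCoord F lam r P Q q Φ l) : 𝓝 0 ≤ map Φ (𝓝 0) := by
  rw [h.hasStrictFDerivAt.map_nhds_eq_of_equiv, h.map_zero]

theorem id_isBigO (h : IsNormalizingCoord F lam r P Q q Φ l) : id =O[𝓝 0] Φ := by
  have hlittle : (fun z => Φ z - z) =o[𝓝 0] (fun z => z) :=
    h.tangent.trans_isLittleO (isLittleO_norm_pow_id one_lt_two)
  exact hlittle.right_isBigO_add.congr_right fun z => sub_add_cancel _ _

theorem tendsto (h : IsNormalizingCoord F lam r P Q q Φ l) : Tendsto Φ (𝓝 0) (𝓝 0) :=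
  h.isBigO_norm.trans_tendsto tendsto_norm_zero

theorem tendsto_resMono (h : IsNormalizingCoord F lam r P Q q Φ l) (hP : P ≠ 0) (hQ : Q ≠ 0) :
    Tendsto (fun z => resMono P Q (Φ z)) (𝓝 0) (𝓝 0) := by
  have := (analyticAt_resMono P Q 0).continuousAt.tendsto
  rw [resMono_zero hP hQ] at this
  exact this.comp h.tendsto

theorem mono_comp_sub_isBigO (h : IsNormalizingCoord F lam r P Q q Φ l)
    (hF : Tendsto F (𝓝 0) (𝓝 0)) (hl : l ≠ 0) (hlam : ∀ j : Fin n, j.val < r → lam j ≠ 0)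
    (hL : ∀ j : Fin n, r ≤ j.val → L j = 0) :
    (fun z => mono (Φ (F z)) L - mono lam L * (mono (Φ z) L *
      mono (1 + fun j => q j (resMono P Q (Φ z)) / lam j) L)) =O[𝓝 0] fun z => ‖z‖ ^ l := by
  let A (z : Fin n → ℂ) (j : Fin n) : ℂ :=
    if j.val < r then Φ z j * (lam j + q j (resMono P Q (Φ z))) else Φ (F z) j
  have hdiff : (fun z => Φ (F z) - A z) =O[𝓝 0] fun z => ‖z‖ ^ l := by
    refine isBigO_pi.2 fun j => ?_
    by_cases hj : j.val < r
    · simpa [A, hj] using h.normal j hj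
    · simpa [A, hj] using isBigO_zero _ _
  have hΦF : Tendsto (fun z => Φ (F z)) (𝓝 0) (𝓝 0) := h.tendsto.comp hF
  have hA : Tendsto A (𝓝 0) (𝓝 0) := by
    have hzero : Tendsto (fun z : Fin n → ℂ => ‖z‖ ^ l) (𝓝 0) (𝓝 0) := by
      simpa [hl] using! (continuous_norm.pow l).tendsto (0 : Fin n → ℂ)
    simpa using hΦF.sub (hdiff.trans_tendsto hzero)
  refine (((analyticAt_mono L 0).hasStrictFDerivAt.isBigO_sub.comp_tendsto
    (hΦF.prodMk_nhds hA)).trans hdiff).congr_left fun z => ?_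
  simp only [Function.comp, mono, ← Finset.prod_mul_distrib, ← mul_pow]
  refine congrArg _ (Finset.prod_congr rfl fun j _ => ?_)
  by_cases hj : j.val < r
  · have := hlam j hj
    simp only [A, if_pos hj, Pi.add_apply, Pi.one_apply]
    field_simp
  · simp [hL j (not_lt.1 hj)]

end IsNormalizingCoord

theorem mono_one_add_div_sub_isBigO (hk : 1 ≤ k) (hfib : ∀ j, fib j =O[𝓝 0] fun u => ‖u‖ ^ k)
    (hq : ∀ j : Fin n, j.val < r →
      (fun u => q j u - lam j * fib j u) =O[𝓝 0] fun u => ‖u‖ ^ (k + 1))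
    (hlam : ∀ j : Fin n, j.val < r → lam j ≠ 0) (hL : ∀ j : Fin n, r ≤ j.val → L j = 0) :
    (fun u => mono (1 + fun j => q j u / lam j) L - (1 + ∑ j, L j * fib j u))
      =O[𝓝 0] fun u => ‖u‖ ^ (k + 1) := by
  have hdiff (j : Fin n) (hj : j.val < r) :
      (fun u => q j u / lam j - fib j u) =O[𝓝 0] fun u => ‖u‖ ^ (k + 1) := by
    refine ((hq j hj).const_mul_left (lam j)⁻¹).congr_left fun u => ?_
    have := hlam j hj
    field_simp
  have hlt (j : Fin n) (hj : L j ≠ 0) : j.val < r := not_le.1 (mt (hL j) hj)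
  have hone : (fun u : ℂ × ℂ => ‖u‖ ^ k) =O[𝓝 0] fun _ => (1 : ℝ) :=
    (isBigO_norm_pow_of_le k.zero_le).congr_right fun u => pow_zero _
  have hmono := mono_one_add_isBigO (L := L) (ζ := fun u j => q j u / lam j) hone fun j hj =>
    (((hdiff j (hlt j hj)).trans (isBigO_norm_pow_of_le k.le_succ)).add (hfib j)).congr_left
      fun u => by ring
  have hsum : (fun u => ∑ j, L j * (q j u / lam j - fib j u)) =O[𝓝 0] fun u => ‖u‖ ^ (k + 1) := by
    refine IsBigO.fun_sum fun j _ => ?_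
    by_cases hj : L j = 0
    · simpa [hj] using isBigO_zero _ _
    · exact (hdiff j (hlt j hj)).const_mul_left _
  have hsq : (fun u : ℂ × ℂ => (‖u‖ ^ k) ^ 2) =O[𝓝 0] fun u => ‖u‖ ^ (k + 1) := by
    simpa only [← pow_mul] using isBigO_norm_pow_of_le (E := ℂ × ℂ) (by lia : k + 1 ≤ k * 2)
  refine ((hmono.trans hsq).add hsum).congr_left fun u => ?_
  simp only [mul_sub, Finset.sum_sub_distrib]
  ring

namespace IsNormalizingCoord

theorem mono_comp_sub_mul_isBigO (h : IsNormalizingCoord F lam r P Q q Φ l)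
    (hF : Tendsto F (𝓝 0) (𝓝 0)) (hP : P ≠ 0) (hQ : Q ≠ 0) (hk : 1 ≤ k) (hl : l ≠ 0)
    (hfib : ∀ j, fib j =O[𝓝 0] fun u => ‖u‖ ^ k)
    (hq : ∀ j : Fin n, j.val < r →
      (fun u => q j u - lam j * fib j u) =O[𝓝 0] fun u => ‖u‖ ^ (k + 1))
    (hlam : ∀ j : Fin n, j.val < r → lam j ≠ 0) (hL : ∀ j : Fin n, r ≤ j.val → L j = 0)
    (hL1 : mono lam L = 1) (hLU : ∀ w, ‖mono w L‖ ≤ ‖resMono P Q w‖) :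
    (fun z => mono (Φ (F z)) L - mono (Φ z) L * (1 + ∑ j, L j * fib j (resMono P Q (Φ z))))
      =O[𝓝 0] fun z => ‖resMono P Q (Φ z)‖ ^ (k + 2) + ‖Φ z‖ ^ l := by
  have hfactor := (mono_one_add_div_sub_isBigO hk hfib hq hlam hL).comp_tendsto
    (h.tendsto_resMono hP hQ)
  have hmain : (fun z => mono (Φ z) L * (mono (1 + fun j => q j (resMono P Q (Φ z)) / lam j) L -
      (1 + ∑ j, L j * fib j (resMono P Q (Φ z)))))
        =O[𝓝 0] fun z => ‖resMono P Q (Φ z)‖ ^ (k + 2) := by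
    refine ((IsBigO.of_norm_le fun z => hLU (Φ z)).mul hfactor).congr_right fun z => ?_
    simp only [Function.comp]
    ring
  refine (isBigO_add_of_nonneg hmain ((h.mono_comp_sub_isBigO hF hl hlam hL).trans
    (h.id_isBigO.norm_norm.pow l)) (fun z => by positivity) fun z => by positivity).congr_left
      fun z => ?_
  rw [hL1]
  ring

theorem isShadowCoord (h : IsNormalizingCoord F lam r P Q q Φ l) (hF : Tendsto F (𝓝 0) (𝓝 0))
    (hP : P ≠ 0) (hQ : Q ≠ 0) (hk : 1 ≤ k) (hl : l ≠ 0)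
    (hfib : ∀ j, fib j =O[𝓝 0] fun u => ‖u‖ ^ k)
    (hq : ∀ j : Fin n, j.val < r →
      (fun u => q j u - lam j * fib j u) =O[𝓝 0] fun u => ‖u‖ ^ (k + 1))
    (hlam : ∀ j : Fin n, j.val < r → lam j ≠ 0)
    (hsupp : ∀ j : Fin n, r ≤ j.val → P j = 0 ∧ Q j = 0)
    (hP1 : mono lam P = 1) (hQ1 : mono lam Q = 1) :
    IsShadowCoord F lam r P Q fib k l Φ where
  map_zero := h.map_zero
  continuousAt := h.analyticAt.eventually_analyticAt.mono fun _ hz => hz.continuousAt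
  nhds_le_map := h.nhds_le_map
  id_isBigO := h.id_isBigO
  base := by
    have hbase₁ := h.mono_comp_sub_mul_isBigO hF hP hQ hk hl hfib hq hlam
      (fun j hj => (hsupp j hj).1) hP1 fun w => norm_fst_le (resMono P Q w)
    have hbase₂ := h.mono_comp_sub_mul_isBigO hF hP hQ hk hl hfib hq hlam
      (fun j hj => (hsupp j hj).2) hQ1 fun w => norm_snd_le (resMono P Q w)
    refine (hbase₁.prod_left hbase₂).congr_left fun z => ?_
    simp only [resMono, shadowMap, Prod.mk_add_mk, Prod.mk_sub_mk]
    congr 1 <;> ring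
  fiber j hj := by
    have hfactor : (fun z => Φ z j * (q j (resMono P Q (Φ z)) - lam j * fib j (resMono P Q (Φ z))))
        =O[𝓝 0] fun z => ‖Φ z‖ * ‖resMono P Q (Φ z)‖ ^ (k + 1) :=
      (IsBigO.of_norm_le fun z => norm_le_pi_norm (Φ z) j).mul
        ((hq j hj).comp_tendsto (h.tendsto_resMono hP hQ))
    refine (isBigO_add_of_nonneg hfactor ((h.normal j hj).trans (h.id_isBigO.norm_norm.pow l))
      (fun z => by positivity) fun z => by positivity).congr_left fun z => ?_
    ring
  contract j hj := (h.contract j hj).trans (h.id_isBigO.norm_norm.pow 2)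

end IsNormalizingCoord

theorem fiberTerm_isBigO (lam : Fin n → ℂ) (k₀ : ℕ) (a : ℕ × ℕ → Fin n → ℂ) (j : Fin n) :
    fiberTerm lam k₀ a j =O[𝓝 0] fun u => ‖u‖ ^ k₀ := by
  refine IsBigO.fun_sum fun k hk => ?_
  rw [Finset.HasAntidiagonal.mem_antidiagonal] at hk
  refine ((monomial_isBigO k hk.ge).const_mul_left (a k j / lam j)).congr_left fun u => ?_
  ring

theorem leadTerm_eq_mul_fiberTerm (k₀ : ℕ) (a : ℕ × ℕ → Fin n → ℂ) {j : Fin n} (h : lam j ≠ 0)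
    (u : ℂ × ℂ) : leadTerm k₀ a j u = lam j * fiberTerm lam k₀ a j u := by
  rw [leadTerm, fiberTerm, Finset.mul_sum]
  refine Finset.sum_congr rfl fun k _ => ?_
  field_simp

theorem IsShadowData.exists_isShadowCoord {k₀ : ℕ} {a : ℕ × ℕ → Fin n → ℂ}
    (ha : IsShadowData F lam r P Q k₀ a) (hPQ : AreGenerators lam r P Q)
    (hlam : ∀ j : Fin n, j.val < r → lam j ≠ 0) (l : ℕ) :
    ∃ l' Φ, l ≤ l' ∧ IsShadowCoord F lam r P Q (fiberTerm lam k₀ a) k₀ l' Φ := by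
  obtain ⟨hk₀, ⟨l₀, ψ, Ft, hl₀, hψ, hFt, hconj, hN⟩, ha0, -⟩ := ha
  obtain ⟨j₀, hj₀⟩ := hPQ.exists_lt
  have hlam₀ := hlam j₀ hj₀
  have hP := hPQ.left_ne_zero
  have hQ := hPQ.right_ne_zero
  obtain ⟨q, Φ, hΦ, hq⟩ := exists_isNormalizingCoord hFt.2.1 hFt.1 hN hPQ
    (antidiagonal_subset_exponents hP hQ
      (fun k hk => hPQ.two_le_len_comb hj₀ hlam₀ (hk₀.trans_eq hk.symm)) fun k hk => hl₀ k hk.le)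
    hl₀ ha0 l
  refine ⟨l₀ + l, _, by lia, (hΦ.isShadowCoord hFt.tendsto hP hQ hk₀ ?_
    (fiberTerm_isBigO lam k₀ a) (fun j hj => ?_) hlam hPQ.1 (hPQ.mono_left hj₀ hlam₀)
    (hPQ.mono_right hj₀ hlam₀)).comp hψ hconj⟩
  · have := hl₀ (0, 0) k₀.zero_le
    lia
  · simpa only [leadTerm_eq_mul_fiberTerm k₀ a (hlam j hj)] using hq j hj

end ShadowCoordinates

section AbelCoordinates

variable {α : Type*} {𝓕 : Filter α}

/-- The Fatou (Abel) coordinate of the parabolic germ `y ↦ y + C * y ^ (m + 1)`, which takes it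
to the translation by `1` up to a small error. -/
def abelCoord (m : ℕ) (C y : ℂ) : ℂ := -(m * C * y ^ m)⁻¹

theorem abelCoord_neg_inv {m : ℕ} (hm : m ≠ 0) (y : ℂ) :
    abelCoord m (-(1 / m)) y = (y ^ m)⁻¹ := by
  have : (m : ℂ) ≠ 0 := Nat.cast_ne_zero.2 hm
  rw [abelCoord, show (m : ℂ) * -(1 / m) * y ^ m = -y ^ m by field_simp, inv_neg, neg_neg]

theorem isLittleO_inv_pow_one_add (m : ℕ) :
    (fun ζ : ℂ => ((1 + ζ) ^ m)⁻¹ - (1 - m * ζ)) =o[𝓝 0] fun ζ => ζ := by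
  have hderiv : HasDerivAt (fun ζ : ℂ => ((1 + ζ) ^ m)⁻¹) (-m) 0 := by
    simpa using! ((((hasDerivAt_id (0 : ℂ)).const_add 1).fun_pow m).fun_inv (by simp))
  refine (hasDerivAt_iff_isLittleO_nhds_zero.1 hderiv).congr_left fun ζ => ?_
  simp only [zero_add, add_zero, one_pow, inv_one, smul_eq_mul]
  ring

theorem abelCoord_mul_one_add (m : ℕ) (C y ζ : ℂ) :
    abelCoord m C (y * (1 + ζ)) = abelCoord m C y * ((1 + ζ) ^ m)⁻¹ := by
  rw [abelCoord, abelCoord, mul_pow, ← mul_assoc, mul_inv, neg_mul]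

theorem abelCoord_sub_sub_isLittleO {m : ℕ} {C : ℂ} {y y' τ : α → ℂ} (hm : m ≠ 0) (hC : C ≠ 0)
    (hy : ∀ᶠ a in 𝓕, y a ≠ 0) (hτ : Tendsto (fun a => τ a * y a ^ m) 𝓕 (𝓝 0))
    (h : (fun a => y' a - y a - C * τ a * y a ^ (m + 1)) =o[𝓕] fun a => τ a * y a ^ (m + 1)) :
    (fun a => abelCoord m C (y' a) - abelCoord m C (y a) - τ a) =o[𝓕] τ := by
  let ζ (a : α) : ℂ := (y' a - y a) / y a
  have hζ : (fun a => ζ a - C * (τ a * y a ^ m)) =o[𝓕] fun a => τ a * y a ^ m := by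
    refine (h.mul_isBigO (isBigO_refl (fun a => (y a)⁻¹) _)).congr' ?_ ?_
    · filter_upwards [hy] with a ha
      simp only [ζ]
      field_simp
      ring
    · filter_upwards [hy] with a ha
      field_simp
      ring
  have hζO : ζ =O[𝓕] fun a => τ a * y a ^ m :=
    (hζ.isBigO.add ((isBigO_refl _ _).const_mul_left C)).congr_left fun a => sub_add_cancel _ _
  have hinv : (fun a => ((1 + ζ a) ^ m)⁻¹ - (1 - m * C * (τ a * y a ^ m)))
      =o[𝓕] fun a => τ a * y a ^ m := by
    refine ((((isLittleO_inv_pow_one_add m).comp_tendsto (hζO.trans_tendsto hτ)).trans_isBigO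
      hζO).sub (hζ.const_mul_left m)).congr_left fun a => ?_
    simp only [Function.comp]
    ring
  have hm' : (m : ℂ) ≠ 0 := Nat.cast_ne_zero.2 hm
  have hprod := (isBigO_refl (fun a => abelCoord m C (y a)) 𝓕).mul_isLittleO hinv
  refine (hprod.congr' ?_ ?_).trans_isBigO ((isBigO_refl τ 𝓕).const_mul_left (-(m * C)⁻¹))
  · filter_upwards [hy] with a ha
    have hy' : y' a = y a * (1 + ζ a) := by
      simp only [ζ]
      field_simp
      ring
    rw [hy', abelCoord_mul_one_add]
    simp only [abelCoord]
    field_simp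
    ring
  · filter_upwards [hy] with a ha
    simp only [abelCoord]
    field_simp

theorem tendsto_nhdsNE_zero_of_re_abelCoord {m : ℕ} {C : ℂ} {y : α → ℂ} (hm : m ≠ 0)
    (hC : C ≠ 0) (h : Tendsto (fun a => (abelCoord m C (y a)).re) 𝓕 atTop) :
    Tendsto y 𝓕 (𝓝[≠] 0) := by
  refine tendsto_nhdsWithin_iff.2 ⟨?_, ?_⟩
  · have hcobdd : Tendsto (fun a => abelCoord m C (y a)) 𝓕 (Bornology.cobounded ℂ) :=
      tendsto_norm_atTop_iff_cobounded.1 (tendsto_atTop_mono (fun a => Complex.re_le_norm _) h)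
    have hpow : Tendsto (fun a => y a ^ m) 𝓕 (𝓝 0) := by
      have hm' : (m : ℂ) ≠ 0 := Nat.cast_ne_zero.2 hm
      have := (tendsto_inv₀_cobounded.comp hcobdd).const_mul (-(m * C)⁻¹)
      rw [mul_zero] at this
      refine this.congr fun a => ?_
      simp only [Function.comp, abelCoord, inv_neg, inv_inv]
      field_simp
    have hlittle : (fun a => y a ^ m) =o[𝓕] fun _ => (1 : ℂ) ^ m := by
      rw [one_pow]
      exact (isLittleO_one_iff ℂ).2 hpow
    exact (isLittleO_one_iff ℂ).1 (IsLittleO.of_pow hlittle hm)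
  · filter_upwards [h.eventually_gt_atTop 0] with a ha hy
    simp [abelCoord, Set.mem_singleton_iff.1 hy, hm] at ha

end AbelCoordinates

section Petals

variable {α : Type*} {𝓕 : Filter α}

theorem norm_le_two_mul_re {κ : ℝ} {τ : ℂ} (hκ₀ : 0 < κ) (hκ : κ ≤ 1)
    (hτ : |τ.im| ≤ κ * τ.re) : ‖τ‖ ≤ 2 * τ.re := by
  have hre : 0 ≤ τ.re := nonneg_of_mul_nonneg_right ((abs_nonneg _).trans hτ) hκ₀
  have := Complex.norm_le_abs_re_add_abs_im τ
  rw [abs_of_nonneg hre] at this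
  nlinarith

theorem eventually_norm_one_add_mul_le {κ : ℝ} {τ f : α → ℂ} {f₀ : ℂ} (hκ₀ : 0 < κ) (hκ : κ ≤ 1)
    (hf₀ : κ * (‖f₀‖ + 4) < -f₀.re) (hτ : Tendsto τ 𝓕 (𝓝 0))
    (hsector : ∀ᶠ a in 𝓕, |(τ a).im| ≤ κ * (τ a).re) (hf : Tendsto f 𝓕 (𝓝 f₀)) :
    ∀ᶠ a in 𝓕, ‖1 + τ a * f a‖ ≤ 1 - κ * ‖τ a‖ := by
  have hre : ∀ᶠ a in 𝓕, κ * (‖f a‖ + 4) < -(f a).re :=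
    ((hf.norm.add_const 4).const_mul κ).eventually_lt
      ((Complex.continuous_re.tendsto _).comp hf).neg hf₀
  have hsmall : ∀ᶠ a in 𝓕, ‖τ a‖ * ‖f a‖ ^ 2 < 2 * κ := by
    refine (hτ.norm.mul (hf.norm.pow 2)).eventually_lt_const ?_
    simpa using hκ₀
  have hle : ∀ᶠ a in 𝓕, κ * ‖τ a‖ < 1 :=
    (hτ.norm.const_mul κ).eventually_lt_const (by simp)
  filter_upwards [hre, hsmall, hle, hsector] with a hre hsmall hle hsector
  have hnorm := norm_le_two_mul_re hκ₀ hκ hsector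
  have hprod : (τ a * f a).re ≤ -2 * κ * ‖τ a‖ := by
    have him : -((τ a).im * (f a).im) ≤ κ * (τ a).re * ‖f a‖ :=
      (neg_le_abs _).trans ((abs_mul _ _).trans_le (mul_le_mul hsector (Complex.abs_im_le_norm _)
        (abs_nonneg _) ((abs_nonneg _).trans hsector)))
    have hτre : 0 ≤ (τ a).re := by linarith [norm_nonneg (τ a)]
    rw [Complex.mul_re]
    nlinarith
  have hsq : ‖1 + τ a * f a‖ ^ 2 = 1 + 2 * (τ a * f a).re + ‖τ a‖ ^ 2 * ‖f a‖ ^ 2 := by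
    rw [← mul_pow, ← norm_mul, Complex.sq_norm, Complex.sq_norm, Complex.normSq_add]
    simp
    ring
  refine abs_le_of_sq_le_sq' ?_ (by linarith) |>.2
  rw [hsq]
  nlinarith [norm_nonneg (τ a), sq_nonneg (κ * ‖τ a‖)]

theorem one_sub_pow_le {c t : ℝ} {N : ℕ} (hN : 4 ≤ N * c) (hct : c * t ≤ 1) (ht₀ : 0 ≤ t)
    (ht : t ≤ 1 / 4) : (1 - c * t) ^ N ≤ 1 - 2 * t := by
  calc (1 - c * t) ^ N ≤ Real.exp (-(c * t)) ^ N :=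
        pow_le_pow_left₀ (by linarith) (by linarith [Real.add_one_le_exp (-(c * t))]) N
    _ = Real.exp (-(N * c * t)) := by rw [← Real.exp_nat_mul]; ring_nf
    _ ≤ Real.exp (-(4 * t)) := Real.exp_le_exp.2 (by nlinarith)
    _ ≤ (1 + 4 * t)⁻¹ := by
        rw [Real.exp_neg]
        exact inv_anti₀ (by linarith) (by linarith [Real.add_one_le_exp (4 * t)])
    _ ≤ 1 - 2 * t := inv_le_of_inv_le₀ (by linarith) (by
        rw [← one_div, div_le_iff₀ (by linarith)]; nlinarith)

/-- An attracting petal, of size `ε`, of a map asymptotic to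
`(x, y) ↦ (x - x ^ (k + 1) / k, y + C * x ^ k * y ^ (σ + 1))`: both Fatou coordinates
`x ^ (-k)` and `abelCoord σ C y` have a large real part, and `x` is negligible with respect to
the increment of `y`. -/
def petal (k σ : ℕ) (C : ℂ) (κ ε : ℝ) : Set (ℂ × ℂ) :=
  {p | ε⁻¹ < ((p.1 ^ k)⁻¹).re ∧ |((p.1 ^ k)⁻¹).im| < κ * ((p.1 ^ k)⁻¹).re ∧
    ε⁻¹ < (abelCoord σ C p.2).re ∧ ‖p.1‖ < ε * ‖p.2‖ ^ (σ + 1)}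

variable {k σ : ℕ} {C : ℂ} {κ : ℝ}

/-- One step `p ↦ p'` of a planar map which preserves the petals of all sizes and increases the
first Fatou coordinate. -/
structure IsPetalStep (k σ : ℕ) (C : ℂ) (κ : ℝ) (p p' : ℂ × ℂ) : Prop where
  fast : ((p.1 ^ k)⁻¹).re + 1 / 2 ≤ ((p'.1 ^ k)⁻¹).re
  sector : |((p'.1 ^ k)⁻¹).im| - κ * ((p'.1 ^ k)⁻¹).re ≤
    |((p.1 ^ k)⁻¹).im| - κ * ((p.1 ^ k)⁻¹).re
  slow : (abelCoord σ C p.2).re ≤ (abelCoord σ C p'.2).re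
  ratio : ‖p'.1‖ * ‖p.2‖ ^ (σ + 1) ≤ ‖p.1‖ * ‖p'.2‖ ^ (σ + 1)

theorem IsPetalStep.mem_petal {ε : ℝ} {p p' : ℂ × ℂ} (h : IsPetalStep k σ C κ p p') (hσ : σ ≠ 0)
    (hε : 0 < ε) (hp : p ∈ petal k σ C κ ε) : p' ∈ petal k σ C κ ε := by
  obtain ⟨hfast, hsector, hslow, hratio⟩ := hp
  refine ⟨by linarith [h.fast], by linarith [h.sector], hslow.trans_le h.slow, ?_⟩
  have hy' : 0 < ‖p'.2‖ := norm_pos_iff.2 fun hy' => by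
    have := (inv_pos.2 hε).trans (hslow.trans_le h.slow)
    simp [abelCoord, hy', hσ] at this
  have hy : 0 < ‖p.2‖ ^ (σ + 1) :=
    pos_of_mul_pos_right ((norm_nonneg _).trans_lt hratio) hε.le
  refine lt_of_mul_lt_mul_right ?_ hy.le
  calc ‖p'.1‖ * ‖p.2‖ ^ (σ + 1) ≤ ‖p.1‖ * ‖p'.2‖ ^ (σ + 1) := h.ratio
    _ < ε * ‖p.2‖ ^ (σ + 1) * ‖p'.2‖ ^ (σ + 1) := by gcongr
    _ = ε * ‖p'.2‖ ^ (σ + 1) * ‖p.2‖ ^ (σ + 1) := by ring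

/-- Convergence of `p` to the origin through the petals. -/
def TendsInPetal (k σ : ℕ) (C : ℂ) (κ : ℝ) (p : α → ℂ × ℂ) (𝓕 : Filter α) : Prop :=
  ∀ ε > 0, ∀ᶠ a in 𝓕, p a ∈ petal k σ C κ ε

namespace TendsInPetal

variable {p p' : α → ℂ × ℂ}

theorem tendsto_re_inv_pow (h : TendsInPetal k σ C κ p 𝓕) :
    Tendsto (fun a => (((p a).1 ^ k)⁻¹).re) 𝓕 atTop :=
  tendsto_atTop.2 fun M => (h (|M| + 1)⁻¹ (by positivity)).mono fun a ha => by
    have := ha.1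
    rw [inv_inv] at this
    linarith [le_abs_self M]

theorem tendsto_re_abelCoord (h : TendsInPetal k σ C κ p 𝓕) :
    Tendsto (fun a => (abelCoord σ C (p a).2).re) 𝓕 atTop :=
  tendsto_atTop.2 fun M => (h (|M| + 1)⁻¹ (by positivity)).mono fun a ha => by
    have := ha.2.2.1
    rw [inv_inv] at this
    linarith [le_abs_self M]

theorem fst_isLittleO (h : TendsInPetal k σ C κ p 𝓕) :
    (fun a => (p a).1) =o[𝓕] fun a => (p a).2 ^ (σ + 1) :=
  IsLittleO.of_bound fun c hc => (h c hc).mono fun a ha => by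
    rw [norm_pow]
    exact ha.2.2.2.le

theorem tendsto_fst (h : TendsInPetal k σ C κ p 𝓕) (hk : k ≠ 0) :
    Tendsto (fun a => (p a).1) 𝓕 (𝓝[≠] 0) := by
  have hC : -(1 / (k : ℂ)) ≠ 0 := by simpa using hk
  refine tendsto_nhdsNE_zero_of_re_abelCoord hk hC ?_
  simpa only [abelCoord_neg_inv hk] using h.tendsto_re_inv_pow

theorem tendsto_snd (h : TendsInPetal k σ C κ p 𝓕) (hσ : σ ≠ 0) (hC : C ≠ 0) :
    Tendsto (fun a => (p a).2) 𝓕 (𝓝[≠] 0) :=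
  tendsto_nhdsNE_zero_of_re_abelCoord hσ hC h.tendsto_re_abelCoord

theorem tendsto_fst_pow (h : TendsInPetal k σ C κ p 𝓕) (hk : k ≠ 0) :
    Tendsto (fun a => (p a).1 ^ k) 𝓕 (𝓝 0) := by
  simpa [hk] using ((h.tendsto_fst hk).mono_right nhdsWithin_le_nhds).pow k

theorem sector (h : TendsInPetal k σ C κ p 𝓕) :
    ∀ᶠ a in 𝓕, |((p a).1 ^ k).im| ≤ κ * ((p a).1 ^ k).re :=
  (h 1 one_pos).mono fun a ha => by
    have := ha.2.1.le
    rwa [Complex.inv_im, Complex.inv_re, neg_div, abs_neg, abs_div,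
      abs_of_nonneg (Complex.normSq_nonneg _), ← mul_div_assoc,
      div_le_div_iff_of_pos_right] at this
    refine Complex.normSq_pos.2 fun hx => ?_
    have := ha.1
    norm_num [hx] at this

theorem inv_pow_sub_sub_one_isLittleO (h : TendsInPetal k σ C κ p 𝓕) (hk : k ≠ 0)
    (hfast : (fun a => (p' a).1 - (p a).1 + (p a).1 ^ (k + 1) / k) =o[𝓕]
      fun a => (p a).1 ^ (k + 1)) :
    (fun a => ((p' a).1 ^ k)⁻¹ - ((p a).1 ^ k)⁻¹ - 1) =o[𝓕] fun _ => (1 : ℂ) := by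
  have hC : -(1 / (k : ℂ)) ≠ 0 := by simpa using hk
  have hne := (tendsto_nhdsWithin_iff.1 (h.tendsto_fst hk)).2
  have := abelCoord_sub_sub_isLittleO (y' := fun a => (p' a).1) (τ := fun _ => 1) hk hC hne
    (by simpa only [one_mul] using h.tendsto_fst_pow hk)
    ((hfast.congr_left fun a => by ring).congr_right fun a => (one_mul _).symm)
  simpa only [abelCoord_neg_inv hk] using this

theorem abelCoord_sub_sub_isLittleO (h : TendsInPetal k σ C κ p 𝓕) (hk : k ≠ 0) (hσ : σ ≠ 0)
    (hC : C ≠ 0)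
    (hslow : (fun a => (p' a).2 - (p a).2 - C * (p a).1 ^ k * (p a).2 ^ (σ + 1)) =o[𝓕]
      fun a => (p a).1 ^ k * (p a).2 ^ (σ + 1)) :
    (fun a => abelCoord σ C (p' a).2 - abelCoord σ C (p a).2 - (p a).1 ^ k) =o[𝓕]
      fun a => (p a).1 ^ k := by
  have hsnd := tendsto_nhdsWithin_iff.1 (h.tendsto_snd hσ hC)
  refine TwoResonant.abelCoord_sub_sub_isLittleO hσ hC hsnd.2 ?_ hslow
  simpa [hσ] using (h.tendsto_fst_pow hk).mul (hsnd.1.pow σ)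

theorem eventually_norm_fst_le (h : TendsInPetal k σ C κ p 𝓕) (hk : k ≠ 0) (hκ₀ : 0 < κ)
    (hκ : κ ≤ 1) (hκk : κ * (1 / k + 4) < 1 / k)
    (hfast : (fun a => (p' a).1 - (p a).1 + (p a).1 ^ (k + 1) / k) =o[𝓕]
      fun a => (p a).1 ^ (k + 1)) :
    ∀ᶠ a in 𝓕, ‖(p' a).1‖ ≤ ‖(p a).1‖ * (1 - κ * ‖(p a).1 ^ k‖) := by
  have hne := (tendsto_nhdsWithin_iff.1 (h.tendsto_fst hk)).2
  have hf : Tendsto (fun a => ((p' a).1 - (p a).1) / (p a).1 ^ (k + 1)) 𝓕 (𝓝 (-(1 / k))) := by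
    have := hfast.tendsto_div_nhds_zero.add_const (-(1 / k : ℂ))
    rw [zero_add] at this
    refine this.congr' (hne.mono fun a (ha : (p a).1 ≠ 0) => ?_)
    field_simp
    ring
  filter_upwards [hne, eventually_norm_one_add_mul_le hκ₀ hκ (by simpa using hκk)
    (h.tendsto_fst_pow hk) h.sector hf] with a (hx : (p a).1 ≠ 0) hle
  calc ‖(p' a).1‖
      = ‖(p a).1‖ * ‖1 + (p a).1 ^ k * (((p' a).1 - (p a).1) / (p a).1 ^ (k + 1))‖ := by
        rw [← norm_mul]
        congr 1
        field_simp
        ring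
    _ ≤ _ := mul_le_mul_of_nonneg_left hle (norm_nonneg _)

theorem eventually_le_norm_fst (hk : k ≠ 0)
    (hfast : (fun a => (p' a).1 - (p a).1 + (p a).1 ^ (k + 1) / k) =o[𝓕]
      fun a => (p a).1 ^ (k + 1)) :
    ∀ᶠ a in 𝓕, ‖(p a).1‖ * (1 - 2 * ‖(p a).1 ^ k‖) ≤ ‖(p' a).1‖ := by
  filter_upwards [hfast.bound one_pos] with a ha
  have hdiv : ‖(p a).1 ^ (k + 1) / k‖ ≤ ‖(p a).1 ^ (k + 1)‖ := by
    rw [norm_div, Complex.norm_natCast]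
    exact div_le_self (norm_nonneg _) (mod_cast Nat.one_le_iff_ne_zero.2 hk)
  have htri : ‖(p a).1‖ ≤ ‖(p' a).1‖ + ‖(p a).1 ^ (k + 1) / k‖ +
      ‖(p' a).1 - (p a).1 + (p a).1 ^ (k + 1) / k‖ := by
    calc ‖(p a).1‖ = ‖(p' a).1 + (p a).1 ^ (k + 1) / k -
          ((p' a).1 - (p a).1 + (p a).1 ^ (k + 1) / k)‖ := by congr 1; ring
      _ ≤ _ := (norm_sub_le _ _).trans (add_le_add_left (norm_add_le _ _) _)
  have hpow : ‖(p a).1 ^ (k + 1)‖ = ‖(p a).1‖ * ‖(p a).1 ^ k‖ := by rw [pow_succ', norm_mul]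
  linarith

theorem eventually_mul_one_sub_le_norm_snd_pow (h : TendsInPetal k σ C κ p 𝓕) (hk : k ≠ 0)
    (hσ : σ ≠ 0) (hC : C ≠ 0) (hκ₀ : 0 < κ)
    (hslow : (fun a => (p' a).2 - (p a).2 - C * (p a).1 ^ k * (p a).2 ^ (σ + 1)) =o[𝓕]
      fun a => (p a).1 ^ k * (p a).2 ^ (σ + 1)) :
    ∀ᶠ a in 𝓕, ‖(p a).2‖ ^ (σ + 1) * (1 - κ * ‖(p a).1 ^ k‖) ≤ ‖(p' a).2‖ ^ (σ + 1) := by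
  have hlittle : (fun a => (p' a).2 - (p a).2) =o[𝓕] fun a => (p a).1 ^ k * (p a).2 := by
    have hO : (fun a => (p' a).2 - (p a).2) =O[𝓕] fun a => (p a).1 ^ k * (p a).2 ^ (σ + 1) :=
      (hslow.isBigO.add ((isBigO_refl _ _).const_mul_left C)).congr_left fun a => by ring
    refine hO.trans_isLittleO ((isBigO_refl _ _).mul_isLittleO ?_)
    refine ((isLittleO_pow_id (by lia : 1 < σ + 1)).comp_tendsto
      ((h.tendsto_snd hσ hC).mono_right nhdsWithin_le_nhds))
  have hpos : (0 : ℝ) < κ / (σ + 1) := by positivity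
  filter_upwards [hlittle.bound hpos,
    ((h.tendsto_fst_pow hk).norm.const_mul (κ / (σ + 1))).eventually_lt_const
      (by simp : κ / (σ + 1) * ‖(0 : ℂ)‖ < 1)] with a ha hsmall
  set t := κ / (σ + 1) * ‖(p a).1 ^ k‖ with ht
  have hy' : ‖(p a).2‖ * (1 - t) ≤ ‖(p' a).2‖ := by
    have := norm_sub_norm_le (p a).2 (p' a).2
    rw [norm_sub_rev] at this
    rw [norm_mul, ← mul_assoc, ← ht] at ha
    linarith
  calc ‖(p a).2‖ ^ (σ + 1) * (1 - κ * ‖(p a).1 ^ k‖)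
      = ‖(p a).2‖ ^ (σ + 1) * (1 + (σ + 1 : ℕ) * -t) := by
        rw [ht]
        push_cast
        field_simp
        ring
    _ ≤ ‖(p a).2‖ ^ (σ + 1) * (1 + -t) ^ (σ + 1) := by
        gcongr
        exact one_add_mul_le_pow (by linarith) _
    _ = (‖(p a).2‖ * (1 - t)) ^ (σ + 1) := by rw [mul_pow, sub_eq_add_neg]
    _ ≤ ‖(p' a).2‖ ^ (σ + 1) := by gcongr

theorem eventually_isPetalStep (h : TendsInPetal k σ C κ p 𝓕) (hk : k ≠ 0) (hσ : σ ≠ 0)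
    (hC : C ≠ 0) (hκ₀ : 0 < κ) (hκ : κ ≤ 1) (hκk : κ * (1 / k + 4) < 1 / k)
    (hfast : (fun a => (p' a).1 - (p a).1 + (p a).1 ^ (k + 1) / k) =o[𝓕]
      fun a => (p a).1 ^ (k + 1))
    (hslow : (fun a => (p' a).2 - (p a).2 - C * (p a).1 ^ k * (p a).2 ^ (σ + 1)) =o[𝓕]
      fun a => (p a).1 ^ k * (p a).2 ^ (σ + 1)) :
    ∀ᶠ a in 𝓕, IsPetalStep k σ C κ (p a) (p' a) := by
  filter_upwards [(h.inv_pow_sub_sub_one_isLittleO hk hfast).bound (half_pos hκ₀),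
    (h.abelCoord_sub_sub_isLittleO hk hσ hC hslow).bound one_half_pos, h.sector,
    h.eventually_norm_fst_le hk hκ₀ hκ hκk hfast,
    h.eventually_mul_one_sub_le_norm_snd_pow hk hσ hC hκ₀ hslow] with a hω hs hsector hx hy
  rw [norm_one, mul_one] at hω
  have hωre := abs_le.1 ((Complex.abs_re_le_norm _).trans hω)
  have hωim := (Complex.abs_im_le_norm _).trans hω
  have hsre := abs_le.1 ((Complex.abs_re_le_norm _).trans hs)
  simp only [Complex.sub_re, Complex.sub_im, Complex.one_re, Complex.one_im, sub_zero]
    at hωre hωim hsre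
  refine ⟨by linarith, ?_, by linarith [norm_le_two_mul_re hκ₀ hκ hsector], ?_⟩
  · have := abs_sub_abs_le_abs_sub (((p' a).1 ^ k)⁻¹).im (((p a).1 ^ k)⁻¹).im
    nlinarith
  · calc ‖(p' a).1‖ * ‖(p a).2‖ ^ (σ + 1)
        ≤ ‖(p a).1‖ * (1 - κ * ‖(p a).1 ^ k‖) * ‖(p a).2‖ ^ (σ + 1) := by gcongr
      _ = ‖(p a).1‖ * (‖(p a).2‖ ^ (σ + 1) * (1 - κ * ‖(p a).1 ^ k‖)) := by ring
      _ ≤ ‖(p a).1‖ * ‖(p' a).2‖ ^ (σ + 1) := by gcongr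

variable {x' z' : α → ℂ} {u₀ : ℂ} {G₁ G₂ g : ℂ → ℂ}

theorem fast_isLittleO (h : TendsInPetal k σ C κ p 𝓕) (hk : k ≠ 0) (hσ : σ ≠ 0) (hC : C ≠ 0)
    (hG₁ : ContinuousAt G₁ 0) (hG₁0 : G₁ 0 = -(1 / k))
    (hx' : (fun a => x' a - (p a).1 * (1 + (p a).1 ^ k * G₁ (p a).2)) =O[𝓕]
      fun a => (p a).1 ^ (k + 2)) :
    (fun a => x' a - (p a).1 + (p a).1 ^ (k + 1) / k) =o[𝓕] fun a => (p a).1 ^ (k + 1) := by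
  have hfst := (h.tendsto_fst hk).mono_right nhdsWithin_le_nhds
  have hsnd := (h.tendsto_snd hσ hC).mono_right nhdsWithin_le_nhds
  have hG : (fun a => G₁ (p a).2 - G₁ 0) =o[𝓕] fun _ => (1 : ℂ) := by
    rw [isLittleO_one_iff]
    exact tendsto_sub_nhds_zero_iff.2 (hG₁.tendsto.comp hsnd)
  refine ((hx'.trans_isLittleO ((isLittleO_pow_pow (by lia : k + 1 < k + 2)).comp_tendsto
    hfst)).add ((isBigO_refl (fun a => (p a).1 ^ (k + 1)) 𝓕).mul_isLittleO hG |>.congr_right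
      fun a => mul_one _)).congr_left fun a => ?_
  rw [hG₁0]
  ring

theorem sub_fst_isLittleO (h : TendsInPetal k σ C κ p 𝓕) (hk : k ≠ 0)
    (hfast : (fun a => x' a - (p a).1 + (p a).1 ^ (k + 1) / k) =o[𝓕] fun a => (p a).1 ^ (k + 1)) :
    (fun a => x' a - (p a).1) =o[𝓕] fun a => (p a).1 := by
  have hpow : (fun a => (p a).1 ^ (k + 1)) =o[𝓕] fun a => (p a).1 :=
    (isLittleO_pow_id (by lia : 1 < k + 1)).comp_tendsto
      ((h.tendsto_fst hk).mono_right nhdsWithin_le_nhds)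
  refine ((hfast.trans hpow).sub (hpow.const_mul_left (k : ℂ)⁻¹)).congr_left fun a => ?_
  ring

theorem slow_numerator_isLittleO (h : TendsInPetal k σ C κ p 𝓕) (hσ : σ ≠ 0) (hC : C ≠ 0)
    (hG : ∀ᶠ y in 𝓝 0, (u₀ + y) * (G₂ y - G₁ y) = y ^ (σ + 1) * g y) (hg : Tendsto g (𝓝 0) (𝓝 C))
    (hxx' : (fun a => x' a - (p a).1) =o[𝓕] fun a => (p a).1)
    (hx' : (fun a => x' a - (p a).1 * (1 + (p a).1 ^ k * G₁ (p a).2)) =O[𝓕]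
      fun a => (p a).1 ^ (k + 2))
    (hz' : (fun a => z' a - (p a).1 * (u₀ + (p a).2) * (1 + (p a).1 ^ k * G₂ (p a).2)) =O[𝓕]
      fun a => (p a).1 ^ (k + 2)) :
    (fun a => z' a - (u₀ + (p a).2) * x' a - C * x' a * (p a).1 ^ k * (p a).2 ^ (σ + 1)) =o[𝓕]
      fun a => (p a).1 ^ (k + 1) * (p a).2 ^ (σ + 1) := by
  have hsnd := (h.tendsto_snd hσ hC).mono_right nhdsWithin_le_nhds
  have herr {f : α → ℂ} (hf : f =O[𝓕] fun a => (p a).1 ^ (k + 2)) :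
      f =o[𝓕] fun a => (p a).1 ^ (k + 1) * (p a).2 ^ (σ + 1) :=
    hf.trans_isLittleO (((isBigO_refl (fun a => (p a).1 ^ (k + 1)) 𝓕).mul_isLittleO
      h.fst_isLittleO).congr_left fun a => by ring)
  have hbdd : (fun a => u₀ + (p a).2) =O[𝓕] fun _ => (1 : ℂ) :=
    (hsnd.const_add u₀).isBigO_one ℂ
  have hlead : (fun a => (p a).1 ^ (k + 1) * (p a).2 ^ (σ + 1) * (g (p a).2 - C)) =o[𝓕]
      fun a => (p a).1 ^ (k + 1) * (p a).2 ^ (σ + 1) := by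
    have : (fun a => g (p a).2 - C) =o[𝓕] fun _ => (1 : ℂ) :=
      (isLittleO_one_iff ℂ).2 (tendsto_sub_nhds_zero_iff.2 (hg.comp hsnd))
    simpa only [mul_one] using (isBigO_refl _ 𝓕).mul_isLittleO this
  have hshift : (fun a => C * ((x' a - (p a).1) * ((p a).1 ^ k * (p a).2 ^ (σ + 1)))) =o[𝓕]
      fun a => (p a).1 ^ (k + 1) * (p a).2 ^ (σ + 1) :=
    ((hxx'.mul_isBigO (isBigO_refl _ _)).const_mul_left C).congr_right fun a => by ring
  have hxerr : (fun a => (u₀ + (p a).2) * (x' a - (p a).1 * (1 + (p a).1 ^ k * G₁ (p a).2)))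
      =O[𝓕] fun a => (p a).1 ^ (k + 2) := by
    simpa only [one_mul] using hbdd.mul hx'
  refine (((herr (hz'.sub hxerr)).add hlead).sub hshift).congr' ?_ .rfl
  filter_upwards [hsnd.eventually hG] with a ha
  linear_combination (p a).1 ^ (k + 1) * -ha

theorem slow_isLittleO (h : TendsInPetal k σ C κ p 𝓕) (hk : k ≠ 0) (hσ : σ ≠ 0) (hC : C ≠ 0)
    (hG : ∀ᶠ y in 𝓝 0, (u₀ + y) * (G₂ y - G₁ y) = y ^ (σ + 1) * g y) (hg : Tendsto g (𝓝 0) (𝓝 C))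
    (hxx' : (fun a => x' a - (p a).1) =o[𝓕] fun a => (p a).1)
    (hx' : (fun a => x' a - (p a).1 * (1 + (p a).1 ^ k * G₁ (p a).2)) =O[𝓕]
      fun a => (p a).1 ^ (k + 2))
    (hz' : (fun a => z' a - (p a).1 * (u₀ + (p a).2) * (1 + (p a).1 ^ k * G₂ (p a).2)) =O[𝓕]
      fun a => (p a).1 ^ (k + 2)) :
    (fun a => z' a / x' a - u₀ - (p a).2 - C * (p a).1 ^ k * (p a).2 ^ (σ + 1)) =o[𝓕]
      fun a => (p a).1 ^ k * (p a).2 ^ (σ + 1) := by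
  have hne := (tendsto_nhdsWithin_iff.1 (h.tendsto_fst hk)).2
  have hxO : (fun a => (p a).1) =O[𝓕] x' :=
    hxx'.right_isBigO_add.congr_right fun a => sub_add_cancel _ _
  have hinv : (fun a => (x' a)⁻¹) =O[𝓕] fun a => (p a).1⁻¹ :=
    hxO.inv_rev (hne.mono fun a hx h0 => absurd h0 hx)
  refine ((h.slow_numerator_isLittleO hσ hC hG hg hxx' hx' hz').mul_isBigO hinv).congr' ?_ ?_
  · filter_upwards [hne, hxO.eq_zero_imp] with a hx himp
    have hx'0 : x' a ≠ 0 := mt himp hx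
    field_simp
    ring
  · filter_upwards [hne] with a (hx : (p a).1 ≠ 0)
    field_simp
    ring

end TendsInPetal

end Petals

section BasinRegions

variable {n r k l σ N : ℕ} {lam : Fin n → ℂ} {P Q : Fin n → ℕ} {fib : Fin n → ℂ × ℂ → ℂ}
  {v : ℂ × ℂ} {C : ℂ} {κ ε : ℝ}

/-- The functions `fib j` are analytic and homogeneous of degree `k`. -/
structure IsHomogeneousFiber (k : ℕ) (fib : Fin n → ℂ × ℂ → ℂ) : Prop where
  analyticAt : ∀ j u, AnalyticAt ℂ (fib j) u
  map_smul : ∀ j c u, fib j (c • u) = c ^ k * fib j u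

/-- The coordinates `(x, y)` on `ℂⁿ` and on the blow-up of `ℂ²` at the origin near the direction
`[v]`, in which `(w ^ P, w ^ Q) = x • (v.1, v.2 + v.1 * y)`. -/
def chart (P Q : Fin n → ℕ) (v : ℂ × ℂ) (w : Fin n → ℂ) : ℂ × ℂ :=
  (mono w P / v.1, mono w Q / mono w P - v.2 / v.1)

/-- A direction `v`, `v.1 ≠ 0`, which is characteristic and irregular for `shadowMap P Q fib`, and
attracting for the fibers `fib j`, `j ≤ r`. In the blow-up coordinate `y` of `chart`, the slow
motion along the exceptional divisor vanishes to order `σ + 1`, with leading coefficient `C`. -/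
structure IsAttractingDirection (P Q : Fin n → ℕ) (fib : Fin n → ℂ × ℂ → ℂ) (r k σ : ℕ) (C : ℂ)
    (v : ℂ × ℂ) : Prop where
  fst_ne_zero : v.1 ≠ 0
  sum_left : ∑ j, P j * fib j v = -(1 / k)
  sum_right : ∑ j, Q j * fib j v = -(1 / k)
  slow : ∃ g : ℂ → ℂ, Tendsto g (𝓝 0) (𝓝 C) ∧ ∀ᶠ y in 𝓝 0,
    (v.2 / v.1 + y) * (∑ j, Q j * fib j (v.1, v.2 + v.1 * y) -
      ∑ j, P j * fib j (v.1, v.2 + v.1 * y)) = y ^ (σ + 1) * g y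
  re_neg : ∀ j : Fin n, j.val < r → (fib j v).re < 0

/-- The candidate basins of size `ε`: `w` is small, `(w ^ P, w ^ Q)` lies in a petal at the
direction `[v]`, and `‖w‖ ^ N` is bounded by the base coordinate. -/
def basinRegion (P Q : Fin n → ℕ) (v : ℂ × ℂ) (k σ : ℕ) (C : ℂ) (κ : ℝ) (N : ℕ) (ε : ℝ) :
    Set (Fin n → ℂ) :=
  {w | ‖w‖ < ε ∧ ‖w‖ ^ N < ‖(chart P Q v w).1‖ ∧ chart P Q v w ∈ petal k σ C κ ε}

/-- One step `w ↦ w'` of a map of `ℂⁿ` which preserves the regions `basinRegion` of all sizes. -/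
structure IsBasinStep (P Q : Fin n → ℕ) (v : ℂ × ℂ) (k σ : ℕ) (C : ℂ) (κ : ℝ) (N : ℕ)
    (w w' : Fin n → ℂ) : Prop where
  norm_le : ‖w'‖ ≤ ‖w‖
  norm_pow_mul_le : ‖w'‖ ^ N * ‖(chart P Q v w).1‖ ≤ ‖w‖ ^ N * ‖(chart P Q v w').1‖
  isPetalStep : IsPetalStep k σ C κ (chart P Q v w) (chart P Q v w')

theorem fst_ne_zero_of_mem_petal {p : ℂ × ℂ} (hp : p ∈ petal k σ C κ ε) (hk : k ≠ 0)
    (hε : 0 < ε) : p.1 ≠ 0 := fun hx => by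
  have := (inv_pos.2 hε).trans hp.1
  simp [hx, hk] at this

theorem IsBasinStep.mem_basinRegion {w w' : Fin n → ℂ}
    (h : IsBasinStep P Q v k σ C κ N w w') (hk : k ≠ 0) (hσ : σ ≠ 0) (hε : 0 < ε)
    (hw : w ∈ basinRegion P Q v k σ C κ N ε) : w' ∈ basinRegion P Q v k σ C κ N ε := by
  obtain ⟨hnorm, hpow, hpetal⟩ := hw
  have hpetal' := h.isPetalStep.mem_petal hσ hε hpetal
  have hx' := norm_pos_iff.2 (fst_ne_zero_of_mem_petal hpetal' hk hε)
  refine ⟨h.norm_le.trans_lt hnorm, ?_, hpetal'⟩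
  refine lt_of_mul_lt_mul_right ?_ (norm_nonneg (chart P Q v w).1)
  calc ‖w'‖ ^ N * ‖(chart P Q v w).1‖ ≤ ‖w‖ ^ N * ‖(chart P Q v w').1‖ := h.norm_pow_mul_le
    _ < ‖(chart P Q v w).1‖ * ‖(chart P Q v w').1‖ := by gcongr
    _ = ‖(chart P Q v w').1‖ * ‖(chart P Q v w).1‖ := mul_comm _ _

variable {α : Type*} {𝓕 : Filter α} {w w' : α → Fin n → ℂ}

/-- Convergence of `w` to the origin through the regions `basinRegion`. -/
def TendsInBasin (P Q : Fin n → ℕ) (v : ℂ × ℂ) (k σ : ℕ) (C : ℂ) (κ : ℝ) (N : ℕ)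
    (w : α → Fin n → ℂ) (𝓕 : Filter α) : Prop :=
  ∀ ε > 0, ∀ᶠ a in 𝓕, w a ∈ basinRegion P Q v k σ C κ N ε

namespace TendsInBasin

theorem tendsInPetal (h : TendsInBasin P Q v k σ C κ N w 𝓕) :
    TendsInPetal k σ C κ (fun a => chart P Q v (w a)) 𝓕 :=
  fun ε hε => (h ε hε).mono fun _ ha => ha.2.2

theorem tendsto_zero (h : TendsInBasin P Q v k σ C κ N w 𝓕) : Tendsto w 𝓕 (𝓝 0) :=
  Metric.tendsto_nhds.2 fun ε hε => (h ε hε).mono fun _ ha => by simpa using ha.1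

theorem norm_pow_isBigO (h : TendsInBasin P Q v k σ C κ N w 𝓕) {m : ℕ} (hl : N * m ≤ l) :
    (fun a => ‖w a‖ ^ l) =O[𝓕] fun a => (chart P Q v (w a)).1 ^ m := by
  refine IsBigO.of_bound 1 ((h 1 one_pos).mono fun a ha => ?_)
  calc ‖‖w a‖ ^ l‖ = ‖w a‖ ^ l := by simp
    _ ≤ ‖w a‖ ^ (N * m) := pow_le_pow_of_le_one (norm_nonneg _) ha.1.le hl
    _ = (‖w a‖ ^ N) ^ m := pow_mul _ _ _
    _ ≤ ‖(chart P Q v (w a)).1‖ ^ m := by gcongr; exact ha.2.1.le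
    _ = 1 * ‖(chart P Q v (w a)).1 ^ m‖ := by rw [norm_pow, one_mul]

theorem resMono_eq (h : TendsInBasin P Q v k σ C κ N w 𝓕) (hk : k ≠ 0) (hv : v.1 ≠ 0) :
    ∀ᶠ a in 𝓕, resMono P Q (w a) =
      (chart P Q v (w a)).1 • (v.1, v.2 + v.1 * (chart P Q v (w a)).2) := by
  filter_upwards [(tendsto_nhdsWithin_iff.1 (h.tendsInPetal.tendsto_fst hk)).2] with a ha
  have hP : mono (w a) P ≠ 0 := fun hP => ha (by simp [chart, hP])
  simp only [resMono, chart, Prod.smul_mk, smul_eq_mul, Prod.mk.injEq]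
  constructor <;> field_simp
  ring

theorem resMono_isBigO (h : TendsInBasin P Q v k σ C κ N w 𝓕) (hk : k ≠ 0) (hσ : σ ≠ 0)
    (hC : C ≠ 0) (hv : v.1 ≠ 0) :
    (fun a => resMono P Q (w a)) =O[𝓕] fun a => (chart P Q v (w a)).1 := by
  have hsnd := (h.tendsInPetal.tendsto_snd hσ hC).mono_right nhdsWithin_le_nhds
  have hbdd : (fun a => (v.1, v.2 + v.1 * (chart P Q v (w a)).2)) =O[𝓕] fun _ => (1 : ℂ) :=
    (tendsto_const_nhds.prodMk_nhds ((hsnd.const_mul v.1).const_add v.2)).isBigO_one ℂ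
  refine ((isBigO_refl (fun a => (chart P Q v (w a)).1) 𝓕).smul hbdd).congr' ?_ ?_
  · filter_upwards [h.resMono_eq hk hv] with a ha using ha.symm
  · simp

theorem fib_resMono_eq (h : TendsInBasin P Q v k σ C κ N w 𝓕) (hk : k ≠ 0) (hv : v.1 ≠ 0)
    (hfib : IsHomogeneousFiber k fib) (j : Fin n) :
    ∀ᶠ a in 𝓕, fib j (resMono P Q (w a)) =
      (chart P Q v (w a)).1 ^ k * fib j (v.1, v.2 + v.1 * (chart P Q v (w a)).2) := by
  filter_upwards [h.resMono_eq hk hv] with a ha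
  rw [ha, hfib.map_smul]

theorem tendsto_fib (h : TendsInBasin P Q v k σ C κ N w 𝓕) (hσ : σ ≠ 0) (hC : C ≠ 0)
    (hfib : IsHomogeneousFiber k fib) (j : Fin n) :
    Tendsto (fun a => fib j (v.1, v.2 + v.1 * (chart P Q v (w a)).2)) 𝓕 (𝓝 (fib j v)) := by
  have hsnd := (h.tendsInPetal.tendsto_snd hσ hC).mono_right nhdsWithin_le_nhds
  have hdir : Tendsto (fun a => (v.1, v.2 + v.1 * (chart P Q v (w a)).2)) 𝓕 (𝓝 v) := by
    simpa using! tendsto_const_nhds.prodMk_nhds ((hsnd.const_mul v.1).const_add v.2)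
  exact (hfib.analyticAt j v).continuousAt.tendsto.comp hdir

theorem base_isBigO (h : TendsInBasin P Q v k σ C κ N w 𝓕) (hk : k ≠ 0) (hσ : σ ≠ 0) (hC : C ≠ 0)
    (hv : v.1 ≠ 0) (hfib : IsHomogeneousFiber k fib) (hl : N * (k + 2) ≤ l)
    (hbase : (fun a => resMono P Q (w' a) - (resMono P Q (w a) +
      shadowMap P Q fib (resMono P Q (w a)))) =O[𝓕]
        fun a => ‖resMono P Q (w a)‖ ^ (k + 2) + ‖w a‖ ^ l) :
    (fun a => mono (w' a) P / v.1 - (chart P Q v (w a)).1 * (1 + (chart P Q v (w a)).1 ^ k *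
      ∑ j, P j * fib j (v.1, v.2 + v.1 * (chart P Q v (w a)).2))) =O[𝓕]
        (fun a => (chart P Q v (w a)).1 ^ (k + 2)) ∧
    (fun a => mono (w' a) Q / v.1 - (chart P Q v (w a)).1 * (v.2 / v.1 + (chart P Q v (w a)).2) *
      (1 + (chart P Q v (w a)).1 ^ k *
        ∑ j, Q j * fib j (v.1, v.2 + v.1 * (chart P Q v (w a)).2))) =O[𝓕]
        fun a => (chart P Q v (w a)).1 ^ (k + 2) := by
  have herr := hbase.trans (((h.resMono_isBigO hk hσ hC hv).norm_left.pow (k + 2)).add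
    (h.norm_pow_isBigO hl))
  have hres := (h.resMono_eq hk hv).and (eventually_all.2 (h.fib_resMono_eq hk hv hfib))
  refine ⟨((isBigO_fst_prod'.trans herr).const_mul_left v.1⁻¹).congr' ?_ .rfl,
    ((isBigO_snd_prod'.trans herr).const_mul_left v.1⁻¹).congr' ?_ .rfl⟩
  all_goals
    filter_upwards [hres] with a ⟨hU, hfibU⟩
    simp only [shadowMap, hfibU, mul_left_comm _ ((chart P Q v (w a)).1 ^ k), ← Finset.mul_sum]
    rw [hU]
    simp only [resMono, Prod.smul_mk, smul_eq_mul, Prod.fst_add, Prod.snd_add, Prod.fst_sub,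
      Prod.snd_sub]
    field_simp

theorem fast_slow_isLittleO (h : TendsInBasin P Q v k σ C κ N w 𝓕) (hk : k ≠ 0) (hσ : σ ≠ 0)
    (hC : C ≠ 0) (hv : IsAttractingDirection P Q fib r k σ C v) (hfib : IsHomogeneousFiber k fib)
    (hl : N * (k + 2) ≤ l)
    (hbase : (fun a => resMono P Q (w' a) - (resMono P Q (w a) +
      shadowMap P Q fib (resMono P Q (w a)))) =O[𝓕]
        fun a => ‖resMono P Q (w a)‖ ^ (k + 2) + ‖w a‖ ^ l) :
    ((fun a => (chart P Q v (w' a)).1 - (chart P Q v (w a)).1 +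
      (chart P Q v (w a)).1 ^ (k + 1) / k) =o[𝓕] fun a => (chart P Q v (w a)).1 ^ (k + 1)) ∧
    (fun a => (chart P Q v (w' a)).2 - (chart P Q v (w a)).2 -
      C * (chart P Q v (w a)).1 ^ k * (chart P Q v (w a)).2 ^ (σ + 1)) =o[𝓕]
        fun a => (chart P Q v (w a)).1 ^ k * (chart P Q v (w a)).2 ^ (σ + 1) := by
  obtain ⟨g, hg, hslow⟩ := hv.slow
  obtain ⟨hx', hz'⟩ := h.base_isBigO hk hσ hC hv.fst_ne_zero hfib hl hbase
  have hG₁ : ContinuousAt (fun y => ∑ j, P j * fib j (v.1, v.2 + v.1 * y)) 0 := by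
    have (j : Fin n) : Continuous (fib j) :=
      continuous_iff_continuousAt.2 fun u => (hfib.analyticAt j u).continuousAt
    fun_prop
  have hfast := h.tendsInPetal.fast_isLittleO hk hσ hC hG₁ (by simpa using hv.sum_left) hx'
  refine ⟨hfast, (h.tendsInPetal.slow_isLittleO hk hσ hC hslow hg
    (h.tendsInPetal.sub_fst_isLittleO hk hfast) hx' hz').congr_left fun a => ?_⟩
  simp only [chart, div_div_div_cancel_right₀ hv.fst_ne_zero]

theorem eventually_norm_apply_le_of_lt (h : TendsInBasin P Q v k σ C κ N w 𝓕) (hk : k ≠ 0)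
    (hσ : σ ≠ 0) (hC : C ≠ 0) (hv : v.1 ≠ 0) (hfib : IsHomogeneousFiber k fib) (hκ₀ : 0 < κ)
    (hκ : κ ≤ 1) (hl : N * (k + 1) + 1 ≤ l) {j : Fin n} (hlam : ‖lam j‖ = 1)
    (hκj : κ * (‖fib j v‖ + 4) < -(fib j v).re)
    (hfiber : (fun a => w' a j - lam j * (w a j * (1 + fib j (resMono P Q (w a))))) =O[𝓕]
      fun a => ‖w a‖ * ‖resMono P Q (w a)‖ ^ (k + 1) + ‖w a‖ ^ l) :
    ∀ᶠ a in 𝓕, ‖w' a j‖ ≤ ‖w a‖ * (1 - κ / 2 * ‖(chart P Q v (w a)).1 ^ k‖) := by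
  have hfst := (h.tendsInPetal.tendsto_fst hk).mono_right nhdsWithin_le_nhds
  have hpow : (fun a => ‖w a‖ ^ l) =O[𝓕] fun a => ‖w a‖ * ‖(chart P Q v (w a)).1‖ ^ (k + 1) := by
    refine ((isBigO_refl (fun a => ‖w a‖) 𝓕).mul (h.norm_pow_isBigO
      (by lia : N * (k + 1) ≤ l - 1)).norm_right).congr (fun a => ?_) fun a => by rw [norm_pow]
    rw [← pow_succ', Nat.sub_add_cancel (by lia)]
  have herr : (fun a => w' a j - lam j * (w a j * (1 + fib j (resMono P Q (w a))))) =o[𝓕]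
      fun a => ‖w a‖ * ‖(chart P Q v (w a)).1‖ ^ k := by
    refine (hfiber.trans (((isBigO_refl _ _).mul ((h.resMono_isBigO hk hσ hC
      hv).norm_norm.pow (k + 1))).add hpow)).trans_isLittleO ((isBigO_refl _ _).mul_isLittleO ?_)
    exact (isLittleO_pow_pow k.lt_succ_self).comp_tendsto
      (tendsto_zero_iff_norm_tendsto_zero.1 hfst)
  filter_upwards [herr.bound (half_pos hκ₀), h.fib_resMono_eq hk hv hfib j,
    eventually_norm_one_add_mul_le hκ₀ hκ hκj (h.tendsInPetal.tendsto_fst_pow hk)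
      h.tendsInPetal.sector (h.tendsto_fib hσ hC hfib j)] with a herr hres hmain
  rw [hres] at herr
  calc ‖w' a j‖ ≤ ‖w' a j - lam j * (w a j * (1 + (chart P Q v (w a)).1 ^ k *
          fib j (v.1, v.2 + v.1 * (chart P Q v (w a)).2)))‖ +
        ‖lam j * (w a j * (1 + (chart P Q v (w a)).1 ^ k *
          fib j (v.1, v.2 + v.1 * (chart P Q v (w a)).2)))‖ := norm_le_norm_sub_add _ _
    _ ≤ κ / 2 * (‖w a‖ * ‖(chart P Q v (w a)).1 ^ k‖) +
        ‖w a‖ * (1 - κ * ‖(chart P Q v (w a)).1 ^ k‖) := by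
      refine add_le_add (herr.trans_eq (by simp)) ?_
      rw [norm_mul, norm_mul, hlam, one_mul]
      exact mul_le_mul (norm_le_pi_norm _ _) hmain (norm_nonneg _) (norm_nonneg _)
    _ = ‖w a‖ * (1 - κ / 2 * ‖(chart P Q v (w a)).1 ^ k‖) := by ring

theorem eventually_norm_apply_le_of_ge (h : TendsInBasin P Q v k σ C κ N w 𝓕) (hk : k ≠ 0)
    {j : Fin n} (hlam : ‖lam j‖ < 1)
    (hcontract : (fun a => w' a j - lam j * w a j) =O[𝓕] fun a => ‖w a‖ ^ 2) :
    ∀ᶠ a in 𝓕, ‖w' a j‖ ≤ ‖w a‖ * (1 - κ / 2 * ‖(chart P Q v (w a)).1 ^ k‖) := by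
  have hlittle : (fun a => w' a j - lam j * w a j) =o[𝓕] fun a => ‖w a‖ :=
    hcontract.trans_isLittleO ((isLittleO_pow_id one_lt_two).comp_tendsto
      (tendsto_zero_iff_norm_tendsto_zero.1 h.tendsto_zero))
  have hsmall : ∀ᶠ a in 𝓕, (1 + ‖lam j‖) / 2 < 1 - κ / 2 * ‖(chart P Q v (w a)).1 ^ k‖ := by
    refine (((h.tendsInPetal.tendsto_fst_pow hk).norm.const_mul (κ / 2)).const_sub
      1).eventually_const_lt ?_
    rw [norm_zero]
    linarith
  filter_upwards [hlittle.bound (half_pos (sub_pos.2 hlam)), hsmall] with a herr hsmall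
  rw [norm_norm] at herr
  calc ‖w' a j‖ ≤ ‖w' a j - lam j * w a j‖ + ‖lam j * w a j‖ := norm_le_norm_sub_add _ _
    _ ≤ (1 - ‖lam j‖) / 2 * ‖w a‖ + ‖lam j‖ * ‖w a‖ := by
      rw [norm_mul]
      gcongr
      exact norm_le_pi_norm _ _
    _ = ‖w a‖ * ((1 + ‖lam j‖) / 2) := by ring
    _ ≤ _ := by gcongr

theorem eventually_isBasinStep (h : TendsInBasin P Q v k σ C κ N w 𝓕) (hk : k ≠ 0) (hσ : σ ≠ 0)
    (hC : C ≠ 0) (hv : IsAttractingDirection P Q fib r k σ C v) (hfib : IsHomogeneousFiber k fib)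
    (hκ₀ : 0 < κ) (hκ : κ ≤ 1) (hκk : κ * (1 / k + 4) < 1 / k)
    (hκfib : ∀ j : Fin n, j.val < r → κ * (‖fib j v‖ + 4) < -(fib j v).re) (hN : 8 ≤ N * κ)
    (hl : N * (k + 2) + 1 ≤ l) (hlam : ∀ j : Fin n, j.val < r → ‖lam j‖ = 1)
    (hlam' : ∀ j : Fin n, r ≤ j.val → ‖lam j‖ < 1)
    (hbase : (fun a => resMono P Q (w' a) - (resMono P Q (w a) +
      shadowMap P Q fib (resMono P Q (w a)))) =O[𝓕]
        fun a => ‖resMono P Q (w a)‖ ^ (k + 2) + ‖w a‖ ^ l)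
    (hfiber : ∀ j : Fin n, j.val < r →
      (fun a => w' a j - lam j * (w a j * (1 + fib j (resMono P Q (w a))))) =O[𝓕]
        fun a => ‖w a‖ * ‖resMono P Q (w a)‖ ^ (k + 1) + ‖w a‖ ^ l)
    (hcontract : ∀ j : Fin n, r ≤ j.val → (fun a => w' a j - lam j * w a j) =O[𝓕]
      fun a => ‖w a‖ ^ 2) :
    ∀ᶠ a in 𝓕, IsBasinStep P Q v k σ C κ N (w a) (w' a) := by
  obtain ⟨hfast, hslow⟩ := h.fast_slow_isLittleO hk hσ hC hv hfib (by lia) hbase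
  have hnorm (j : Fin n) :
      ∀ᶠ a in 𝓕, ‖w' a j‖ ≤ ‖w a‖ * (1 - κ / 2 * ‖(chart P Q v (w a)).1 ^ k‖) := by
    rcases lt_or_ge j.val r with hj | hj
    · exact h.eventually_norm_apply_le_of_lt hk hσ hC hv.fst_ne_zero hfib hκ₀ hκ
        (by lia) (hlam j hj) (hκfib j hj) (hfiber j hj)
    · exact h.eventually_norm_apply_le_of_ge hk (hlam' j hj) (hcontract j hj)
  filter_upwards [h.tendsInPetal.eventually_isPetalStep hk hσ hC hκ₀ hκ hκk hfast hslow,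
    TendsInPetal.eventually_le_norm_fst hk hfast, eventually_all.2 hnorm,
    (h.tendsInPetal.tendsto_fst_pow hk).norm.eventually_lt_const
      (by simp : ‖(0 : ℂ)‖ < 1 / 4)] with a hpetal hx hnorm hsmall
  set t := ‖(chart P Q v (w a)).1 ^ k‖
  have ht : 0 ≤ t := norm_nonneg _
  have hle : ‖w' a‖ ≤ ‖w a‖ * (1 - κ / 2 * t) :=
    (pi_norm_le_iff_of_nonneg (mul_nonneg (norm_nonneg _) (by nlinarith))).2 hnorm
  refine ⟨hle.trans (mul_le_of_le_one_right (norm_nonneg _) (by nlinarith)), ?_, hpetal⟩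
  calc ‖w' a‖ ^ N * ‖(chart P Q v (w a)).1‖
      ≤ (‖w a‖ * (1 - κ / 2 * t)) ^ N * ‖(chart P Q v (w a)).1‖ := by gcongr
    _ = ‖w a‖ ^ N * (‖(chart P Q v (w a)).1‖ * (1 - κ / 2 * t) ^ N) := by rw [mul_pow]; ring
    _ ≤ ‖w a‖ ^ N * (‖(chart P Q v (w a)).1‖ * (1 - 2 * t)) := by
      gcongr
      exact one_sub_pow_le (by linarith) (by nlinarith) ht hsmall.le
    _ ≤ ‖w a‖ ^ N * ‖(chart P Q v (w' a)).1‖ := by gcongr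

end TendsInBasin

end BasinRegions

section Basins

variable {n r k l σ N : ℕ} {F Φ : (Fin n → ℂ) → (Fin n → ℂ)} {lam : Fin n → ℂ} {P Q : Fin n → ℕ}
  {fib : Fin n → ℂ × ℂ → ℂ} {v : ℂ × ℂ} {C : ℂ} {κ ε : ℝ}

theorem petal_mono {ε' : ℝ} (hε : 0 < ε) (h : ε ≤ ε') : petal k σ C κ ε ⊆ petal k σ C κ ε' :=
  fun _ ⟨hfast, hsector, hslow, hratio⟩ => ⟨(inv_anti₀ hε h).trans_lt hfast, hsector,
    (inv_anti₀ hε h).trans_lt hslow, hratio.trans_le (by gcongr)⟩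

theorem basinRegion_mono {ε' : ℝ} (hε : 0 < ε) (h : ε ≤ ε') :
    basinRegion P Q v k σ C κ N ε ⊆ basinRegion P Q v k σ C κ N ε' :=
  fun _ ⟨hnorm, hpow, hpetal⟩ => ⟨hnorm.trans_le h, hpow, petal_mono hε h hpetal⟩

theorem snd_ne_zero_of_mem_petal {p : ℂ × ℂ} (hp : p ∈ petal k σ C κ ε) : p.2 ≠ 0 := fun hy => by
  have := hp.2.2.2
  rw [hy, norm_zero, zero_pow σ.succ_ne_zero, mul_zero] at this
  exact (norm_nonneg _).not_gt this

theorem isOpen_petal (hk : k ≠ 0) (hσ : σ ≠ 0) (hC : C ≠ 0) (hε : 0 < ε) :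
    IsOpen (petal k σ C κ ε) := by
  refine isOpen_iff_mem_nhds.2 fun p hp => ?_
  have hx : p.1 ^ k ≠ 0 := pow_ne_zero k (fst_ne_zero_of_mem_petal hp hk hε)
  have hy : σ * C * p.2 ^ σ ≠ 0 :=
    mul_ne_zero (mul_ne_zero (Nat.cast_ne_zero.2 hσ) hC)
      (pow_ne_zero σ (snd_ne_zero_of_mem_petal hp))
  have hfast : ContinuousAt (fun p : ℂ × ℂ => (p.1 ^ k)⁻¹) p := by fun_prop (disch := exact hx)
  have hslow : ContinuousAt (fun p : ℂ × ℂ => abelCoord σ C p.2) p := by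
    unfold abelCoord
    fun_prop (disch := exact hy)
  have hre := Complex.continuous_re.continuousAt.comp hfast
  have him := Complex.continuous_im.continuousAt.comp hfast
  exact (continuousAt_const.eventually_lt hre hp.1).and <|
    (him.abs.eventually_lt (continuousAt_const.mul hre) hp.2.1).and <|
    (continuousAt_const.eventually_lt (Complex.continuous_re.continuousAt.comp hslow)
      hp.2.2.1).and <|
    continuousAt_fst.norm.eventually_lt (continuousAt_const.mul (continuousAt_snd.norm.pow (σ + 1)))
      hp.2.2.2

theorem isOpen_basinRegion (hk : k ≠ 0) (hσ : σ ≠ 0) (hC : C ≠ 0) (hε : 0 < ε) :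
    IsOpen (basinRegion P Q v k σ C κ N ε) := by
  refine isOpen_iff_mem_nhds.2 fun w hw => ?_
  have hP : mono w P ≠ 0 := fun hP => fst_ne_zero_of_mem_petal hw.2.2 hk hε (by simp [chart, hP])
  have hchart : ContinuousAt (chart P Q v) w :=
    ((analyticAt_mono P w).continuousAt.div_const v.1).prodMk
      (((analyticAt_mono Q w).continuousAt.div (analyticAt_mono P w).continuousAt hP).sub
        continuousAt_const)
  exact (continuous_norm.continuousAt.eventually_lt continuousAt_const hw.1).and <|
    ((continuous_norm.pow N).continuousAt.eventually_lt (continuousAt_fst.comp hchart).norm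
      hw.2.1).and (hchart ((isOpen_petal hk hσ hC hε).mem_nhds hw.2.2))

theorem exists_sum_mul_eq (hPQ : LinearIndependent ℚ ![fun i => (P i : ℚ), fun i => (Q i : ℚ)])
    (a b : ℂ) : ∃ c : Fin n → ℂ, ∑ j, P j * c j = a ∧ ∑ j, Q j * c j = b := by
  set M : Matrix (Fin 2) (Fin n) ℚ := ![fun i => (P i : ℚ), fun i => (Q i : ℚ)]
  have hsurj : Function.Surjective M.mulVec := by
    refine LinearMap.range_eq_top.1 (Submodule.eq_top_of_finrank_eq (S := M.mulVecLin.range) ?_)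
    rw [Module.finrank_fin_fun]
    exact hPQ.rank_matrix.trans (Fintype.card_fin 2)
  obtain ⟨B, hB⟩ := Matrix.mulVec_surjective_iff_exists_right_inverse.1 hsurj
  have hBC : M.map (algebraMap ℚ ℂ) * B.map (algebraMap ℚ ℂ) = 1 := by
    rw [← Matrix.map_mul, hB, Matrix.map_one _ (map_zero _) (map_one _)]
  have hc : (M.map (algebraMap ℚ ℂ)).mulVec ((B.map (algebraMap ℚ ℂ)).mulVec ![a, b]) =
      ![a, b] := by
    rw [Matrix.mulVec_mulVec, hBC, Matrix.one_mulVec]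
  refine ⟨(B.map (algebraMap ℚ ℂ)).mulVec ![a, b], ?_, ?_⟩
  · simpa [Matrix.mulVec, dotProduct, M] using! congrFun hc 0
  · simpa [Matrix.mulVec, dotProduct, M] using! congrFun hc 1

theorem exists_lt_re_abelCoord (hσ : σ ≠ 0) (hC : C ≠ 0) (u₀ : ℂ) (S : ℝ) :
    ∃ y : ℂ, y ≠ 0 ∧ u₀ + y ≠ 0 ∧ S < (abelCoord σ C y).re := by
  obtain ⟨T, hT, hTu⟩ : ∃ T : ℝ, max 0 S < T ∧ abelCoord σ C (-u₀) ≠ T := by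
    obtain ⟨T, hT, hne⟩ := ((Set.Ioi_infinite (max 0 S)).sdiff
      (Set.finite_singleton (abelCoord σ C (-u₀)).re)).nonempty
    exact ⟨T, hT, fun h => hne (by simp [h])⟩
  obtain ⟨y, hy⟩ := IsAlgClosed.exists_pow_nat_eq (-(σ * C * T)⁻¹ : ℂ) (Nat.pos_of_ne_zero hσ)
  have hT₀ : (T : ℂ) ≠ 0 := Complex.ofReal_ne_zero.2 ((le_max_left _ _).trans_lt hT).ne'
  have hyT : abelCoord σ C y = T := by
    rw [abelCoord, hy]
    field_simp
  refine ⟨y, ?_, fun h => hTu ?_, ?_⟩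
  · rintro rfl
    exact hT₀ (by simp [← hyT, abelCoord, hσ])
  · rwa [← eq_neg_of_add_eq_zero_right h]
  · rw [hyT, Complex.ofReal_re]
    exact (le_max_right _ _).trans_lt hT

theorem eventually_exp_neg_mem_petal (hk : k ≠ 0) (hκ : 0 < κ) (hε : 0 < ε) {y : ℂ} (hy : y ≠ 0)
    (hslow : ε⁻¹ < (abelCoord σ C y).re) :
    ∀ᶠ t : ℝ in atTop, (Complex.exp (-t), y) ∈ petal k σ C κ ε := by
  have hk₀ : (0 : ℝ) < k := Nat.cast_pos.2 (Nat.pos_of_ne_zero hk)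
  filter_upwards [(Real.tendsto_exp_atTop.comp
      (tendsto_id.const_mul_atTop hk₀)).eventually_gt_atTop ε⁻¹,
    Real.tendsto_exp_neg_atTop_nhds_zero.eventually_lt_const
      (mul_pos hε (pow_pos (norm_pos_iff.2 hy) (σ + 1)))] with t hfast hratio
  have hpow : (Complex.exp (-t) ^ k)⁻¹ = (Real.exp (k * t) : ℂ) := by
    rw [← Complex.exp_nat_mul, ← Complex.exp_neg]
    push_cast
    ring_nf
  refine ⟨?_, ?_, hslow, ?_⟩
  · rwa [hpow, Complex.ofReal_re]
  · rw [hpow, Complex.ofReal_re, Complex.ofReal_im, abs_zero]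
    positivity
  · simpa [Complex.norm_exp] using hratio

theorem mono_exp (c : Fin n → ℂ) (L : Fin n → ℕ) :
    mono (fun j => Complex.exp (c j)) L = Complex.exp (∑ j, L j * c j) := by
  simp only [mono, Complex.exp_sum, Complex.exp_nat_mul]

theorem eventually_norm_exp_lt (c : Fin n → ℂ) {α : Fin n → ℝ} {β : ℝ} (hα : ∀ j, β < α j) :
    ∀ᶠ t : ℝ in atTop, ‖fun j => Complex.exp (c j - α j * t)‖ < Real.exp (-(β * t)) := by
  have hcoord (j : Fin n) :
      ∀ᶠ t : ℝ in atTop, ‖Complex.exp (c j - α j * t)‖ < Real.exp (-(β * t)) := by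
    filter_upwards [(tendsto_id.const_mul_atTop (sub_pos.2 (hα j))).eventually_gt_atTop (c j).re]
      with t ht
    rw [Complex.norm_exp, Real.exp_lt_exp, Complex.sub_re, ← Complex.ofReal_mul, Complex.ofReal_re]
    rw [id, sub_mul] at ht
    linarith
  filter_upwards [eventually_all.2 hcoord] with t ht
  exact (pi_norm_lt_iff (Real.exp_pos _)).2 ht

theorem frequently_mem_basinRegion
    (hPQ : LinearIndependent ℚ ![fun i => (P i : ℚ), fun i => (Q i : ℚ)]) (hv : v.1 ≠ 0)
    (hk : k ≠ 0) (hσ : σ ≠ 0) (hC : C ≠ 0) (hκ : 0 < κ) (hε : 0 < ε) (hN : N ≠ 0) {α : Fin n → ℝ}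
    (hP : ∑ j, P j * α j = 1) (hQ : ∑ j, Q j * α j = 1) (hα : ∀ j, (N : ℝ)⁻¹ < α j) :
    ∃ᶠ w in 𝓝 (0 : Fin n → ℂ), w ∈ basinRegion P Q v k σ C κ N ε := by
  obtain ⟨y, hy, huy, hslow⟩ := exists_lt_re_abelCoord hσ hC (v.2 / v.1) ε⁻¹
  obtain ⟨c, hPc, hQc⟩ := exists_sum_mul_eq hPQ (Complex.log v.1)
    (Complex.log (v.1 * (v.2 / v.1 + y)))
  set w : ℝ → Fin n → ℂ := fun t j => Complex.exp (c j - α j * t)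
  have hmono {L : Fin n → ℕ} (hL : ∑ j, L j * α j = 1) (t : ℝ) :
      mono (w t) L = Complex.exp (∑ j, L j * c j) * Complex.exp (-t) := by
    have hLC : ∑ j, (L j : ℂ) * α j = 1 := by exact_mod_cast hL
    rw [mono_exp, ← Complex.exp_add, ← sub_eq_add_neg]
    simp only [mul_sub, ← mul_assoc, Finset.sum_sub_distrib, ← Finset.sum_mul, hLC, one_mul]
  have hchart (t : ℝ) : chart P Q v (w t) = (Complex.exp (-t), y) := by
    have hexp := Complex.exp_ne_zero (-t)
    rw [chart, hmono hP, hmono hQ, hPc, hQc, Complex.exp_log hv,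
      Complex.exp_log (mul_ne_zero hv huy)]
    ext <;> field_simp
    ring
  have hw : ∀ᶠ t in atTop, ‖w t‖ < Real.exp (-((N : ℝ)⁻¹ * t)) := eventually_norm_exp_lt c hα
  have hlim : Tendsto (fun t : ℝ => Real.exp (-((N : ℝ)⁻¹ * t))) atTop (𝓝 0) :=
    Real.tendsto_exp_neg_atTop_nhds_zero.comp (tendsto_id.const_mul_atTop (by positivity))
  refine (squeeze_zero_norm' (hw.mono fun t => le_of_lt) hlim).frequently (Eventually.frequently ?_)
  filter_upwards [hw, hlim.eventually_lt_const hε, eventually_exp_neg_mem_petal hk hκ hε hy hslow]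
    with t hw hsmall hpetal
  rw [← hchart t] at hpetal
  refine ⟨hw.trans hsmall, ?_, hpetal⟩
  calc ‖w t‖ ^ N < Real.exp (-((N : ℝ)⁻¹ * t)) ^ N := by gcongr
    _ = ‖(chart P Q v (w t)).1‖ := by
      rw [hchart, ← Real.exp_nat_mul, mul_neg, mul_inv_cancel_left₀ (Nat.cast_ne_zero.2 hN),
        Complex.norm_exp, Complex.neg_re, Complex.ofReal_re]

theorem tendsto_zero_of_forall_isBasinStep {w : ℕ → Fin n → ℂ} (hk : k ≠ 0) (hσ : σ ≠ 0)
    (hε : 0 < ε) (hw : w 0 ∈ basinRegion P Q v k σ C κ N ε)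
    (hstep : ∀ m, IsBasinStep P Q v k σ C κ N (w m) (w (m + 1))) : Tendsto w atTop (𝓝 0) := by
  set ω : ℕ → ℝ := fun m => (((chart P Q v (w m)).1 ^ k)⁻¹).re
  have hmem (m : ℕ) : w m ∈ basinRegion P Q v k σ C κ N ε := by
    induction m with
    | zero => exact hw
    | succ m ih => exact (hstep m).mem_basinRegion hk hσ hε ih
  have hω (m : ℕ) : ω 0 + m * (1 / 2) ≤ ω m := by
    induction m with
    | zero => simp
    | succ m ih =>
      push_cast
      linarith [(hstep m).isPetalStep.fast]
  have hlim : Tendsto ω atTop atTop := tendsto_atTop_mono hω (tendsto_atTop_add_const_left _ _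
    (tendsto_natCast_atTop_atTop.atTop_mul_const one_half_pos))
  have hx : Tendsto (fun m => (chart P Q v (w m)).1) atTop (𝓝 0) := by
    have hC : -(1 / (k : ℂ)) ≠ 0 := by simpa using hk
    refine (tendsto_nhdsNE_zero_of_re_abelCoord hk hC ?_).mono_right nhdsWithin_le_nhds
    simpa only [abelCoord_neg_inv hk] using hlim
  have hpow : Tendsto (fun m => ‖w m‖ ^ N) atTop (𝓝 0) :=
    squeeze_zero (fun m => by positivity) (fun m => (hmem m).2.1.le)
      (tendsto_zero_iff_norm_tendsto_zero.1 hx)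
  refine Metric.tendsto_nhds.2 fun δ hδ =>
    (hpow.eventually_lt_const (pow_pos hδ N)).mono fun m hm => ?_
  rw [dist_zero_right]
  exact lt_of_pow_lt_pow_left₀ N hδ.le hm

namespace IsShadowCoord

theorem exists_isBasinStep (hΦ : IsShadowCoord F lam r P Q fib k l Φ) (hk : k ≠ 0) (hσ : σ ≠ 0)
    (hC : C ≠ 0) (hv : IsAttractingDirection P Q fib r k σ C v) (hfib : IsHomogeneousFiber k fib)
    (hκ₀ : 0 < κ) (hκ : κ ≤ 1) (hκk : κ * (1 / k + 4) < 1 / k)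
    (hκfib : ∀ j : Fin n, j.val < r → κ * (‖fib j v‖ + 4) < -(fib j v).re) (hN : 8 ≤ N * κ)
    (hl : N * (k + 2) + 1 ≤ l) (hlam : ∀ j : Fin n, j.val < r → ‖lam j‖ = 1)
    (hlam' : ∀ j : Fin n, r ≤ j.val → ‖lam j‖ < 1) :
    ∃ ε > 0, ∀ᶠ z in 𝓝 0, Φ z ∈ basinRegion P Q v k σ C κ N ε →
      IsBasinStep P Q v k σ C κ N (Φ z) (Φ (F z)) := by
  set 𝓕 : Filter (ℝ × (Fin n → ℂ)) :=
    (𝓝[>] 0 ×ˢ 𝓝 0) ⊓ 𝓟 {p | Φ p.2 ∈ basinRegion P Q v k σ C κ N p.1}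
  have hsnd : Tendsto Prod.snd 𝓕 (𝓝 0) := tendsto_snd.mono_left inf_le_left
  have hfst : Tendsto Prod.fst 𝓕 (𝓝[>] 0) := tendsto_fst.mono_left inf_le_left
  have hbasin : TendsInBasin P Q v k σ C κ N (fun p => Φ p.2) 𝓕 := fun ε hε => by
    filter_upwards [hfst (Ioo_mem_nhdsGT hε), mem_inf_of_right (mem_principal_self _)]
      with p hp hmem
    exact basinRegion_mono hp.1 hp.2.le hmem
  have hstep := hbasin.eventually_isBasinStep (w' := fun p : ℝ × (Fin n → ℂ) => Φ (F p.2)) hk hσ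
    hC hv hfib hκ₀ hκ hκk hκfib hN hl hlam hlam' (hΦ.base.comp_tendsto hsnd)
    (fun j hj => (hΦ.fiber j hj).comp_tendsto hsnd)
    fun j hj => (hΦ.contract j hj).comp_tendsto hsnd
  obtain ⟨ε, h, hε⟩ :=
    ((eventually_inf_principal.1 hstep).curry.and self_mem_nhdsWithin).exists
  exact ⟨ε, hε, h⟩

theorem exists_isBasinAtBoundary_of_isBasinStep (hΦ : IsShadowCoord F lam r P Q fib k l Φ)
    (hF : Tendsto F (𝓝 0) (𝓝 0)) (hP : P ≠ 0) (hk : k ≠ 0) (hσ : σ ≠ 0) (hC : C ≠ 0)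
    (hstep : ∃ ε > 0, ∀ᶠ z in 𝓝 0, Φ z ∈ basinRegion P Q v k σ C κ N ε →
      IsBasinStep P Q v k σ C κ N (Φ z) (Φ (F z)))
    (hfreq : ∀ ε > 0, ∃ᶠ w in 𝓝 (0 : Fin n → ℂ), w ∈ basinRegion P Q v k σ C κ N ε)
    {W : Set (Fin n → ℂ)} (hW : W ∈ 𝓝 0) : ∃ V ⊆ W, IsBasinAtBoundary F V := by
  obtain ⟨ε₀, hε₀, hstep⟩ := hstep
  obtain ⟨K, hK, hbound⟩ := hΦ.id_isBigO.exists_pos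
  obtain ⟨d, hd, hball⟩ := Metric.nhds_basis_ball.eventually_iff.1 ((eventually_mem_set.2 hW).and
    (hΦ.continuousAt.and (hstep.and (hbound.bound.and (hF.eventually hbound.bound)))))
  set ε := min ε₀ (d / K)
  have hε : 0 < ε := lt_min hε₀ (div_pos hd hK)
  have hopen : IsOpen (basinRegion P Q v k σ C κ N ε) := isOpen_basinRegion hk hσ hC hε
  set V := {z ∈ Metric.ball 0 d | Φ z ∈ basinRegion P Q v k σ C κ N ε}
  have hstepV {z} (hz : z ∈ V) : IsBasinStep P Q v k σ C κ N (Φ z) (Φ (F z)) :=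
    (hball hz.1).2.2.1 (basinRegion_mono hε (min_le_left _ _) hz.2)
  have hmaps : Set.MapsTo F V V := fun z hz => by
    have hmem := (hstepV hz).mem_basinRegion hk hσ hε hz.2
    refine ⟨mem_ball_zero_iff.2 ((hball hz.1).2.2.2.2.trans_lt ?_), hmem⟩
    rw [mul_comm, ← lt_div_iff₀ hK]
    exact hmem.1.trans_le (min_le_right _ _)
  have hcl : (0 : Fin n → ℂ) ∈ closure V := mem_closure_iff_frequently.2 <|
    ((frequently_map.1 ((hfreq ε hε).filter_mono hΦ.nhds_le_map)).and_eventually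
      (Metric.ball_mem_nhds 0 hd)).mono fun z hz => ⟨hz.2, hz.1⟩
  have h0V : (0 : Fin n → ℂ) ∉ V := fun h => by
    refine fst_ne_zero_of_mem_petal h.2.2.2 hk hε ?_
    simp [chart, hΦ.map_zero, mono_zero hP]
  refine ⟨V, fun z hz => (hball hz.1).1, isOpen_iff_mem_nhds.2 fun z hz => ?_,
    closure_nonempty_iff.1 ⟨0, hcl⟩, ⟨hcl, fun h => h0V (interior_subset h)⟩, hmaps, fun z hz => ?_⟩
  · exact inter_mem (Metric.isOpen_ball.mem_nhds hz.1) ((hball hz.1).2.1 (hopen.mem_nhds hz.2))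
  · have hmem (m : ℕ) : F^[m] z ∈ V := hmaps.iterate m hz
    have hlim : Tendsto (fun m => Φ (F^[m] z)) atTop (𝓝 0) :=
      tendsto_zero_of_forall_isBasinStep hk hσ hε hz.2 fun m => by
        simpa only [Function.iterate_succ_apply'] using hstepV (hmem m)
    exact squeeze_zero_norm (fun m => (hball (hmem m).1).2.2.2.1)
      (by simpa using hlim.norm.const_mul K)

end IsShadowCoord

theorem exists_sector_width (hk : k ≠ 0)
    (hre : ∀ j : Fin n, j.val < r → (fib j v).re < 0) :
    ∃ κ : ℝ, 0 < κ ∧ κ ≤ 1 ∧ κ * (1 / k + 4) < 1 / k ∧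
      ∀ j : Fin n, j.val < r → κ * (‖fib j v‖ + 4) < -(fib j v).re := by
  have hsmall {b : ℝ} (a : ℝ) (hb : 0 < b) : ∀ᶠ κ in 𝓝[>] (0 : ℝ), κ * a < b :=
    ((continuous_mul_const a).tendsto' 0 0 (zero_mul a)).eventually_lt_const hb |>.filter_mono
      nhdsWithin_le_nhds
  have hfib : ∀ᶠ κ in 𝓝[>] (0 : ℝ), ∀ j : Fin n, j.val < r →
      κ * (‖fib j v‖ + 4) < -(fib j v).re :=
    eventually_all.2 fun j => eventually_imp_distrib_left.2 fun hj =>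
      hsmall _ (neg_pos.2 (hre j hj))
  exact ((eventually_mem_nhdsWithin (s := Set.Ioi (0 : ℝ))).and
    ((eventually_nhdsWithin_of_eventually_nhds (eventually_le_nhds one_pos)).and
      ((hsmall _ (by positivity)).and hfib))).exists

theorem IsAttractingDirection.exists_rates (hv : IsAttractingDirection P Q fib r k σ C v)
    (hk : k ≠ 0) (hsupp : ∀ j : Fin n, r ≤ j.val → P j = 0 ∧ Q j = 0) {β : ℝ} (hβ : β < 1)
    (hβfib : ∀ j : Fin n, j.val < r → β < -(fib j v).re) :
    ∃ α : Fin n → ℝ, ∑ j, P j * α j = 1 ∧ ∑ j, Q j * α j = 1 ∧ ∀ j, β < α j := by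
  have hsum {L : Fin n → ℕ} (hL : ∀ j : Fin n, r ≤ j.val → L j = 0)
      (h : ∑ j, (L j : ℂ) * fib j v = -(1 / k)) :
      ∑ j, L j * (if j.val < r then -k * (fib j v).re else 1) = 1 := by
    have hre : ∑ j, L j * (fib j v).re = -(1 / k) := by
      simpa using! congrArg Complex.re h
    calc ∑ j, L j * (if j.val < r then -k * (fib j v).re else 1)
        = ∑ j, -k * (L j * (fib j v).re) := Finset.sum_congr rfl fun j _ => by
          split_ifs with hj
          · ring
          · simp [hL j (not_lt.1 hj)]
      _ = 1 := by
          rw [← Finset.mul_sum, hre]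
          field_simp
  refine ⟨_, hsum (fun j hj => (hsupp j hj).1) hv.sum_left,
    hsum (fun j hj => (hsupp j hj).2) hv.sum_right, fun j => ?_⟩
  split_ifs with hj
  · have hk₁ : (1 : ℝ) ≤ k := Nat.one_le_cast.2 (Nat.one_le_iff_ne_zero.2 hk)
    nlinarith [hβfib j hj, hv.re_neg j hj]
  · exact hβ

theorem exists_isBasinAtBoundary (hF : Tendsto F (𝓝 0) (𝓝 0))
    (hshadow : ∀ l, ∃ l' Φ, l ≤ l' ∧ IsShadowCoord F lam r P Q fib k l' Φ)
    (hPQ : LinearIndependent ℚ ![fun i => (P i : ℚ), fun i => (Q i : ℚ)])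
    (hsupp : ∀ j : Fin n, r ≤ j.val → P j = 0 ∧ Q j = 0) (hk : k ≠ 0) (hσ : σ ≠ 0) (hC : C ≠ 0)
    (hv : IsAttractingDirection P Q fib r k σ C v) (hfib : IsHomogeneousFiber k fib)
    (hlam : ∀ j : Fin n, j.val < r → ‖lam j‖ = 1)
    (hlam' : ∀ j : Fin n, r ≤ j.val → ‖lam j‖ < 1) {W : Set (Fin n → ℂ)} (hW : W ∈ 𝓝 0) :
    ∃ V ⊆ W, IsBasinAtBoundary F V := by
  obtain ⟨κ, hκ₀, hκ, hκk, hκfib⟩ := exists_sector_width hk hv.re_neg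
  obtain ⟨N, hN⟩ := exists_nat_ge (8 / κ)
  rw [div_le_iff₀ hκ₀] at hN
  have hN₀ : N ≠ 0 := by
    rintro rfl
    norm_num at hN
  obtain ⟨l, Φ, hl, hΦ⟩ := hshadow (N * (k + 2) + 1)
  have hNκ : (N : ℝ)⁻¹ < κ := by
    rw [inv_lt_iff_one_lt_mul₀ (by positivity)]
    linarith
  obtain ⟨α, hP, hQ, hα⟩ := hv.exists_rates hk hsupp (hNκ.trans_le hκ) fun j hj => by
    nlinarith [hκfib j hj, norm_nonneg (fib j v)]
  have hP₀ : P ≠ 0 := by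
    rintro rfl
    simp at hP
  exact hΦ.exists_isBasinAtBoundary_of_isBasinStep hF hP₀ hk hσ hC
    (hΦ.exists_isBasinStep hk hσ hC hv hfib hκ₀ hκ hκk hκfib hN hl hlam hlam')
    (fun ε hε => frequently_mem_basinRegion hPQ hv.fst_ne_zero hk hσ hC hκ₀ hε hN₀ hP hQ hα) hW

end Basins

section IrregularDirections

variable {n r k l : ℕ} {lam : Fin n → ℂ} {P Q : Fin n → ℕ} {fib : Fin n → ℂ × ℂ → ℂ} {v : ℂ × ℂ}

theorem IsIrregularAt.exists_eq_pow_mul {H : ℂ × ℂ → ℂ × ℂ} {u₀ : ℂ} (h : IsIrregularAt H u₀)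
    (hH : AnalyticAt ℂ (fun u => H (1, u)) u₀) :
    ∃ σ ≠ 0, ∃ g, ContinuousAt g u₀ ∧ g u₀ ≠ 0 ∧
      ∀ᶠ u in 𝓝 u₀, (H (1, u)).2 - u * (H (1, u)).1 = (u - u₀) ^ (σ + 1) * g u := by
  have hD : AnalyticAt ℂ (fun u => (H (1, u)).2 - u * (H (1, u)).1) u₀ :=
    (analyticAt_snd.comp hH).sub (analyticAt_id.mul (analyticAt_fst.comp hH))
  obtain ⟨m, hm⟩ := ENat.ne_top_iff_exists.1 h.1
  obtain ⟨g, hg, hg₀, hgD⟩ := hD.analyticOrderAt_eq_natCast.1 hm.symm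
  have hm₁ : 1 < m := by
    have := le_add_self.trans_lt (hm.symm ▸ h.2)
    exact_mod_cast this
  obtain ⟨σ, rfl⟩ : ∃ σ, m = σ + 1 := ⟨m - 1, by lia⟩
  exact ⟨σ, by lia, g, hg.continuousAt, hg₀, hgD⟩

namespace IsHomogeneousFiber

theorem analyticAt_shadowMap (hfib : IsHomogeneousFiber k fib) (u : ℂ × ℂ) :
    AnalyticAt ℂ (shadowMap P Q fib) u := by
  have hsum (L : Fin n → ℕ) : AnalyticAt ℂ (fun u => ∑ j, (L j : ℂ) * fib j u) u :=
    Finset.analyticAt_fun_sum _ fun j _ => analyticAt_const.mul (hfib.analyticAt j u)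
  exact (analyticAt_fst.mul (hsum P)).prod (analyticAt_snd.mul (hsum Q))

theorem sum_mul_eq (hfib : IsHomogeneousFiber k fib) (L : Fin n → ℕ) (hv : v.1 ≠ 0) (y : ℂ) :
    ∑ j, L j * fib j (v.1, v.2 + v.1 * y) =
      v.1 ^ k * ∑ j, L j * fib j (1, v.2 / v.1 + y) := by
  have hsmul : (v.1, v.2 + v.1 * y) = v.1 • ((1 : ℂ), v.2 / v.1 + y) := by
    simp only [Prod.smul_mk, smul_eq_mul, mul_one, mul_add, mul_div_cancel₀ v.2 hv]
  simp only [hsmul, hfib.map_smul, Finset.mul_sum, mul_left_comm]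

theorem exists_slow (hfib : IsHomogeneousFiber k fib) (hv : v.1 ≠ 0)
    (hirr : IsIrregularAt (shadowMap P Q fib) (v.2 / v.1)) :
    ∃ σ ≠ 0, ∃ C ≠ 0, ∃ g : ℂ → ℂ, Tendsto g (𝓝 0) (𝓝 C) ∧ ∀ᶠ y in 𝓝 0,
      (v.2 / v.1 + y) * (∑ j, Q j * fib j (v.1, v.2 + v.1 * y) -
        ∑ j, P j * fib j (v.1, v.2 + v.1 * y)) = y ^ (σ + 1) * g y := by
  obtain ⟨σ, hσ, g, hg, hg₀, hgD⟩ := hirr.exists_eq_pow_mul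
    ((hfib.analyticAt_shadowMap _).comp (analyticAt_const.prod analyticAt_id))
  have hshift : Tendsto (fun y => v.2 / v.1 + y) (𝓝 0) (𝓝 (v.2 / v.1)) :=
    (continuous_const_add _).tendsto' _ _ (add_zero _)
  refine ⟨σ, hσ, v.1 ^ k * g (v.2 / v.1), mul_ne_zero (pow_ne_zero k hv) hg₀,
    fun y => v.1 ^ k * g (v.2 / v.1 + y), (hg.tendsto.comp hshift).const_mul _, ?_⟩
  filter_upwards [hshift.eventually hgD] with y hy
  simp only [shadowMap, add_sub_cancel_left, one_mul] at hy
  rw [hfib.sum_mul_eq Q hv, hfib.sum_mul_eq P hv]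
  linear_combination v.1 ^ k * hy

theorem sum_left_eq_sum_right_of_slow (hfib : IsHomogeneousFiber k fib) (hv : v.2 = 0) {σ : ℕ}
    (hσ : σ ≠ 0) {C : ℂ} {g : ℂ → ℂ} (hg : Tendsto g (𝓝 0) (𝓝 C))
    (hslow : ∀ᶠ y in 𝓝 0, (v.2 / v.1 + y) * (∑ j, Q j * fib j (v.1, v.2 + v.1 * y) -
      ∑ j, P j * fib j (v.1, v.2 + v.1 * y)) = y ^ (σ + 1) * g y) :
    ∑ j, P j * fib j v = ∑ j, Q j * fib j v := by
  have hcont (j : Fin n) : Continuous (fib j) :=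
    continuous_iff_continuousAt.2 fun u => (hfib.analyticAt j u).continuousAt
  have hleft : Tendsto (fun y => ∑ j, Q j * fib j (v.1, v.2 + v.1 * y) -
      ∑ j, P j * fib j (v.1, v.2 + v.1 * y)) (𝓝[≠] 0)
        (𝓝 (∑ j, Q j * fib j v - ∑ j, P j * fib j v)) :=
    (Continuous.tendsto' (by fun_prop) _ _ (by simp)).mono_left nhdsWithin_le_nhds
  have hright : Tendsto (fun y => y ^ σ * g y) (𝓝[≠] 0) (𝓝 0) := by
    have := (((continuous_pow σ).tendsto' (0 : ℂ) 0 (zero_pow hσ)).mul hg)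
    rw [zero_mul] at this
    exact this.mono_left nhdsWithin_le_nhds
  refine (sub_eq_zero.1 (tendsto_nhds_unique hleft (hright.congr' ?_))).symm
  filter_upwards [hslow.filter_mono nhdsWithin_le_nhds, self_mem_nhdsWithin] with y hy hy₀
  rw [hv, zero_div, zero_add, pow_succ', mul_assoc] at hy
  rw [hv, mul_left_cancel₀ hy₀ hy]

theorem exists_isAttractingDirection (hfib : IsHomogeneousFiber k fib) (hv : v.1 ≠ 0)
    (hdir : IsNormalizedDirection (shadowMap P Q fib) k v)
    (hirr : IsIrregularAt (shadowMap P Q fib) (v.2 / v.1))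
    (hre : ∀ j : Fin n, j.val < r → (fib j v).re < 0) :
    ∃ σ ≠ 0, ∃ C ≠ 0, IsAttractingDirection P Q fib r k σ C v := by
  obtain ⟨σ, hσ, C, hC, g, hg, hslow⟩ := hfib.exists_slow hv hirr
  have hleft : ∑ j, P j * fib j v = -(1 / k) :=
    mul_left_cancel₀ hv ((congrArg Prod.fst hdir.2).trans (mul_comm _ _))
  refine ⟨σ, hσ, C, hC, hv, hleft, ?_, ⟨g, hg, hslow⟩, hre⟩
  by_cases hv₂ : v.2 = 0
  · rw [← hfib.sum_left_eq_sum_right_of_slow hv₂ hσ hg hslow, hleft]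
  · exact mul_left_cancel₀ hv₂ ((congrArg Prod.snd hdir.2).trans (mul_comm _ _))

theorem comp_swap (hfib : IsHomogeneousFiber k fib) :
    IsHomogeneousFiber k fun j u => fib j u.swap where
  analyticAt j u := (hfib.analyticAt j u.swap).comp (analyticAt_snd.prod analyticAt_fst)
  map_smul j c u := hfib.map_smul j c u.swap

end IsHomogeneousFiber

theorem isHomogeneousFiber_fiberTerm (lam : Fin n → ℂ) (k : ℕ) (a : ℕ × ℕ → Fin n → ℂ) :
    IsHomogeneousFiber k (fiberTerm lam k a) where
  analyticAt _ _ := Finset.analyticAt_fun_sum _ fun _ _ =>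
    (analyticAt_const.mul (analyticAt_fst.pow _)).mul (analyticAt_snd.pow _)
  map_smul j c u := by
    simp only [fiberTerm, Finset.mul_sum, Prod.smul_fst, Prod.smul_snd, smul_eq_mul]
    refine Finset.sum_congr rfl fun i hi => ?_
    rw [← Finset.HasAntidiagonal.mem_antidiagonal.1 hi]
    ring

theorem IsShadowCoord.swap {F Φ : (Fin n → ℂ) → (Fin n → ℂ)}
    (h : IsShadowCoord F lam r P Q fib k l Φ) :
    IsShadowCoord F lam r Q P (fun j u => fib j u.swap) k l Φ := by
  have hnorm (w : Fin n → ℂ) : ‖resMono Q P w‖ = ‖resMono P Q w‖ := max_comm _ _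
  refine { h with base := ?_, fiber := fun j hj => ?_ }
  · simp only [hnorm]
    exact (isBigO_of_le _ fun z => (max_comm _ _).le).trans h.base
  · simp only [hnorm]
    exact h.fiber j hj

theorem shadowTerm_eq_shadowMap (lam : Fin n → ℂ) (k : ℕ) (a : ℕ × ℕ → Fin n → ℂ)
    (hsupp : ∀ j : Fin n, r ≤ j.val → P j = 0 ∧ Q j = 0) :
    shadowTerm lam r P Q k a = shadowMap P Q (fiberTerm lam k a) := by
  have hsum {L : Fin n → ℕ} (hL : ∀ j : Fin n, r ≤ j.val → L j = 0) (u : ℂ × ℂ) :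
      ∑ i ∈ Finset.HasAntidiagonal.antidiagonal k,
        (∑ j : Fin n with j.val < r, (L j : ℂ) * (a i j / lam j)) * u.1 ^ i.1 * u.2 ^ i.2 =
      ∑ j, (L j : ℂ) * fiberTerm lam k a j u := by
    simp only [fiberTerm, Finset.mul_sum, Finset.sum_mul]
    rw [Finset.sum_comm, Finset.sum_filter]
    refine Finset.sum_congr rfl fun j _ => ?_
    split_ifs with hj
    · exact Finset.sum_congr rfl fun i _ => by ring
    · simp [hL j (not_lt.1 hj)]
  funext u
  simp only [shadowTerm, shadowMap, hsum fun j hj => (hsupp j hj).1,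
    hsum fun j hj => (hsupp j hj).2]

end IrregularDirections

theorem exists_isBasinAtBoundary_of_isIrregularAt {n r k : ℕ} {F : (Fin n → ℂ) → Fin n → ℂ}
    {lam : Fin n → ℂ} {P Q : Fin n → ℕ} {fib : Fin n → ℂ × ℂ → ℂ} {v : ℂ × ℂ}
    (hF : Tendsto F (𝓝 0) (𝓝 0))
    (hshadow : ∀ l, ∃ l' Φ, l ≤ l' ∧ IsShadowCoord F lam r P Q fib k l' Φ)
    (hPQ : AreGenerators lam r P Q) (hk : k ≠ 0) (hfib : IsHomogeneousFiber k fib)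
    (hv : v.1 ≠ 0) (hdir : IsNormalizedDirection (shadowMap P Q fib) k v)
    (hirr : IsIrregularAt (shadowMap P Q fib) (v.2 / v.1))
    (hre : ∀ j : Fin n, j.val < r → (fib j v).re < 0)
    (hlam : ∀ j : Fin n, j.val < r → ‖lam j‖ = 1)
    (hlam' : ∀ j : Fin n, r ≤ j.val → ‖lam j‖ < 1) {W : Set (Fin n → ℂ)} (hW : W ∈ 𝓝 0) :
    ∃ V ⊆ W, IsBasinAtBoundary F V := by
  obtain ⟨σ, hσ, C, hC, hattr⟩ := hfib.exists_isAttractingDirection hv hdir hirr hre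
  exact exists_isBasinAtBoundary hF hshadow hPQ.2.1 hPQ.1 hk hσ hC hattr hfib hlam hlam' hW

end TwoResonant

end

/-- The basin is found inside any prescribed neighbourhood `W` of the origin, so that it does not
depend on the representative of the germ `F`. -/
theorem theorem1p2 {n : ℕ} (r : ℕ) (hr : 1 ≤ r) (hrn : r ≤ n)
    (F : (Fin n → ℂ) → (Fin n → ℂ)) (hF : TwoResonant.IsGermBiholo F)
    (lam : Fin n → ℂ) (hlam : TwoResonant.HasEigenvalues F lam)
    (P Q : Fin n → ℕ) (hPQ : TwoResonant.AreGenerators lam r P Q)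
    (h_one : ∀ j : Fin n, j.val < r → ‖lam j‖ = 1)
    (h_lt : ∀ j : Fin n, r ≤ j.val → ‖lam j‖ < 1)
    (h_shadow : ∃ (k₀ : ℕ) (a : ℕ × ℕ → Fin n → ℂ) (v : ℂ × ℂ),
      TwoResonant.IsShadowData F lam r P Q k₀ a ∧
      TwoResonant.IsIrregularNondegenerate lam r P Q k₀ a v ∧
      TwoResonant.IsParabolicallyAttracting lam r P Q k₀ a v) :
    ∀ W ∈ 𝓝 (0 : Fin n → ℂ), ∃ V ⊆ W, TwoResonant.IsBasinAtBoundary F V := by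
  intro W hW
  obtain ⟨k₀, a, v, hdata, ⟨hdir, hirr⟩, -, hre⟩ := h_shadow
  have hk : k₀ ≠ 0 := Nat.one_le_iff_ne_zero.1 hdata.1
  have hlam₀ : ∀ j : Fin n, j.val < r → lam j ≠ 0 := fun j hj =>
    norm_pos_iff.1 (one_pos.trans_eq (h_one j hj).symm)
  have hshadow := hdata.exists_isShadowCoord hPQ hlam₀
  have hfib := TwoResonant.isHomogeneousFiber_fiberTerm lam k₀ a
  rw [TwoResonant.shadowTerm_eq_shadowMap lam k₀ a hPQ.1] at hdir hirr
  rcases hirr with ⟨hv, hirr⟩ | ⟨hv₁, hv₂, hirr⟩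
  · exact TwoResonant.exists_isBasinAtBoundary_of_isIrregularAt hF.tendsto hshadow hPQ hk hfib hv
      hdir hirr hre h_one h_lt hW
  · have hdir_swap : TwoResonant.IsNormalizedDirection
        (TwoResonant.shadowMap Q P fun j u => TwoResonant.fiberTerm lam k₀ a j u.swap) k₀ v.swap :=
      ⟨fun h => hdir.1 (Prod.swap_injective h), congrArg Prod.swap hdir.2⟩
    have hslope : v.swap.2 / v.swap.1 = 0 := by simp [hv₁]
    exact TwoResonant.exists_isBasinAtBoundary_of_isIrregularAt hF.tendsto
      (fun l => (hshadow l).imp fun _ => Exists.imp fun _ => And.imp_right fun h => h.swap)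
      hPQ.swap hk hfib.comp_swap hv₂ hdir_swap (hslope ▸ hirr) hre h_one h_lt hW
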